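/- Let $\ell\ge 4$ be an odd integer and let $\Phi$ be a (reduced, crystallographic) root system of type $D_\ell$ in a Euclidean space $E$, with simple roots $\alpha_1,\dots,\alpha_\ell$ numbered so that $\alpha_1,\dots,\alpha_{\ell-2}$ form a chain in the Dynkin diagram and $\alpha_{\ell-1},\alpha_\ell$ are both joined to $\alpha_{\ell-2}$. Let $W$ be its Weyl group and $Z=\{x\in E : (\alpha,x)\in\mathbb Z \text{ for all }\alpha\in\Phi\}$ its coweight lattice. For an integer $q\ge 1$ let $\pi_q:Z\to Z/qZ$ be the projection and let $$M(\Phi;q)=\{\pi_q(x)\in Z/qZ : (\alpha,x)\not\equiv 0 \pmod q \text{ for all }\alpha\in\Phi\},$$ on which $W$ acts by $w\,\pi_q(x)=\pi_q(w x)$. Let $\chi_{\Phi,q}$ be the permutation character of $W$ on $M(\Phi;q)$, so $\chi_{\Phi,q}(w)$ is the number of points of $M(\Phi;q)$ fixed by $w$. For $j\in\{1,\ell-1,\ell\}$ put $\omega_j=w_jw_0$, where $w_0$ is the longest element of $W$ and $w_j$ is the longest element of the parabolic subgroup generated by the reflections in the simple roots other than $\alpha_j$. **Theorem.** For every integer $q\ge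 1$: 1. $\chi_{\Phi,q}(1)=(q-1)(q-3)\cdots(q-(2\ell-3))\,(q-(\ell-1))$ if $q$ is odd, and $\chi_{\Phi,q}(1)=(q-2)(q-4)\cdots(q-2(\ell-2))\left(q^2-2(\ell-1)q+\frac{\ell(\ell-1)}2\right)$ if $q$ is even. 2. $\chi_{\Phi,q}(\omega_1)=0$ if $q$ is odd, and $\chi_{\Phi,q}(\omega_1)=(q-2)(q-4)\cdots(q-2(\ell-2))$ if $q$ is even. 3. Each $\omega\in\{\omega_{\ell-1},\omega_\ell\}$ has order $4$, and $\chi_{\Phi,q}(\omega)=0$ if $4\nmid q$, while $\chi_{\Phi,q}(\omega)=2(q-4)(q-8)\cdots(q-2(\ell-3))$ if $4\mid q$. -/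

import Mathlib

/-!
Conventions.  A root system in a Euclidean space `E` is a Mathlib root system
`P : RootPairing ι ℝ M N`: the roots `α = P.root i` live in `M`, and `N` is the dual space, which
for a Euclidean space is identified with `E` through the inner product, so that
`P.root' i x = (α, x)` and `P.coroot i` is `α^∨ = 2α / (α, α)`.
-/

namespace EquivariantQuasi

noncomputable section

/-! ### Length and longest elements -/

/-- The length of `w` with respect to `S`: the least length of a word in `S` with product `w`
(used only for generating sets made of involutions). -/
def wordLength {G : Type*} [Group G] (S : Set G) (w : G) : ℕ :=
  sInf {n : ℕ | ∃ l : List G, (∀ s ∈ l, s ∈ S) ∧ l.prod = w ∧ l.length = n}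

/-- `w` is an element of maximal length in the subgroup generated by `S`. -/
def IsLongest {G : Type*} [Group G] (S : Set G) (w : G) : Prop :=
  w ∈ Subgroup.closure S ∧
    ∀ v ∈ Subgroup.closure S, wordLength S v ≤ wordLength S w

theorem exists_isLongest {G : Type*} [Group G] [Finite G] (S : Set G) :
    ∃ w, IsLongest S w := by
  obtain ⟨w, hw, h⟩ := Set.exists_max_image (Subgroup.closure S : Set G) (wordLength S)
    (Set.toFinite _) ⟨1, Subgroup.one_mem _⟩
  exact ⟨w, hw, h⟩

/-- The longest element of the subgroup generated by `S`. -/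
def longestElement {G : Type*} [Group G] (S : Set G) : G :=
  Classical.epsilon (IsLongest S)

section RootSystem

variable {ι M N : Type*} [AddCommGroup M] [Module ℝ M] [AddCommGroup N] [Module ℝ N]

/-! ### The Weyl group and its action on the coweight lattice -/

/-- The linear action of the Weyl group `W` on the space `N` containing the coweight lattice.
Mathlib's `coweightEquiv` is contravariant, hence the inverse. -/
def coweightAction (P : RootPairing ι ℝ M N) : P.weylGroup →* (N ≃ₗ[ℝ] N) where
  toFun w := RootPairing.Equiv.coweightEquiv P P (w : RootPairing.Aut P)⁻¹
  map_one' := by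
    ext x
    simp
  map_mul' v w := by
    rw [Subgroup.coe_mul, mul_inv_rev]
    exact congrArg MulOpposite.unop
      (map_mul (RootPairing.Equiv.coweightHom P) (w : RootPairing.Aut P)⁻¹ (v : RootPairing.Aut P)⁻¹)

/-- The reflection in the root `α` acts by `x ↦ x - (α, x) α^∨`. -/
theorem coweightAction_ofIdx (P : RootPairing ι ℝ M N) (i : ι) (x : N) :
    coweightAction P (RootPairing.weylGroup.ofIdx P i) x = x - P.root' i x • P.coroot i := by
  change RootPairing.Equiv.coweightEquiv P P (RootPairing.Equiv.reflection P i)⁻¹ x = _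
  rw [RootPairing.Equiv.reflection_inv, RootPairing.Equiv.reflection_coweightEquiv,
    RootPairing.coreflection_apply]

theorem root'_coweightAction (P : RootPairing ι ℝ M N) (w : P.weylGroup) (i : ι) (x : N) :
    P.root' i (coweightAction P w x) = P.root' (P.weylGroupToPerm w⁻¹ i) x := by
  have h := RootPairing.Hom.weight_coweight_transpose_apply P P x (w⁻¹ : P.weylGroup).1.toHom
  have h' := LinearMap.congr_fun h (P.root i)
  rw [LinearMap.dualMap_apply, RootPairing.Hom.root_weightMap_apply] at h'
  exact h'.symm

/-- The Weyl group of a root system is finite, so its longest elements exist. -/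
theorem finite_weylGroup [Finite ι] (P : RootPairing ι ℝ M N) [P.IsRootSystem] :
    Finite P.weylGroup := by
  have hinj : Function.Injective P.weylGroupToPerm := by
    intro v w h
    apply Subtype.ext
    apply RootPairing.Equiv.weightHom_injective P
    apply LinearEquiv.toLinearMap_injective
    refine LinearMap.ext_on_range (v := P.root) ?_ fun i => ?_
    · exact RootPairing.IsRootSystem.span_root_eq_top
    · have hv := P.weylGroup_apply_root v i
      have hw := P.weylGroup_apply_root w i
      rw [h, ← hw] at hv
      exact hv
  exact Finite.of_injective _ hinj

/-- The coweight lattice `Z = {x | (α, x) ∈ ℤ for all roots α}`. -/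
def coweightLattice (P : RootPairing ι ℝ M N) : AddSubgroup N where
  carrier := {x | ∀ i, ∃ m : ℤ, P.root' i x = m}
  zero_mem' := fun i => ⟨0, by simp⟩
  add_mem' := by
    intro x y hx hy i
    obtain ⟨m, hm⟩ := hx i
    obtain ⟨n, hn⟩ := hy i
    exact ⟨m + n, by rw [map_add, hm, hn, Int.cast_add]⟩
  neg_mem' := by
    intro x hx i
    obtain ⟨m, hm⟩ := hx i
    exact ⟨-m, by rw [map_neg, hm, Int.cast_neg]⟩

/-- The action of an element of `W` on `Z`. -/
def latticeAction (P : RootPairing ι ℝ M N) (w : P.weylGroup) :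
    coweightLattice P →+ coweightLattice P where
  toFun x := ⟨coweightAction P w x, fun i => by
    obtain ⟨m, hm⟩ := x.2 (P.weylGroupToPerm w⁻¹ i)
    exact ⟨m, by rw [root'_coweightAction, hm]⟩⟩
  map_zero' := by ext; simp
  map_add' x y := by ext; simp

/-! ### Reduction modulo `q` -/

/-- The sublattice `qZ` of `Z`. -/
def multiples (P : RootPairing ι ℝ M N) (q : ℕ) : AddSubgroup (coweightLattice P) :=
  (nsmulAddMonoidHom (α := coweightLattice P) q).range

/-- The finite abelian group `Z / qZ`. -/
abbrev ModLattice (P : RootPairing ι ℝ M N) (q : ℕ) : Type _ :=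
  coweightLattice P ⧸ multiples P q

/-- The action `π_q(x) ↦ π_q(w x)` of `w ∈ W` on `Z / qZ`. -/
def modAction (P : RootPairing ι ℝ M N) (q : ℕ) (w : P.weylGroup) :
    ModLattice P q →+ ModLattice P q :=
  QuotientAddGroup.map (multiples P q) (multiples P q) (latticeAction P w) (by
    rintro _ ⟨x, rfl⟩
    exact ⟨latticeAction P w x, by simp⟩)

/-- The mod `q` complement of the Coxeter arrangement:
`M(Φ; q) = {π_q(x) ∈ Z / qZ | (α, x) ≢ 0 (mod q) for all roots α}`. -/
def modComplement (P : RootPairing ι ℝ M N) (q : ℕ) : Set (ModLattice P q) :=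
  {y | ∃ x : coweightLattice P, (x : ModLattice P q) = y ∧
    ∀ i, ¬ ∃ m : ℤ, P.root' i (x : N) = (q : ℝ) * m}

/-- The equivariant characteristic quasi-polynomial `χ_{Φ,q}`: the permutation character of `W`
on `M(Φ; q)`, whose value at `w` is the number of points of `M(Φ; q)` fixed by `w`. -/
def equivChar (P : RootPairing ι ℝ M N) (q : ℕ) (w : P.weylGroup) : ℕ :=
  Nat.card {y : ModLattice P q // y ∈ modComplement P q ∧ modAction P q w y = y}

/-! ### The elements `ω_j` -/

/-- The simple reflections in the simple roots whose index lies in `J`. -/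
def reflectionsIn (P : RootPairing ι ℝ M N) (J : Set ι) : Set P.weylGroup :=
  RootPairing.weylGroup.ofIdx P '' J

/-- `ω_j = w_j w_0`, where `w_0` is the longest element of `W` (with respect to the simple
reflections) and `w_j` is the longest element of the parabolic subgroup of `W` generated by the
reflections in the simple roots other than `α_j`. -/
def omega {P : RootPairing ι ℝ M N} (b : P.Base) (j : b.support) : P.weylGroup :=
  longestElement (reflectionsIn P {i | i ∈ b.support ∧ i ≠ j}) *
    longestElement (reflectionsIn P {i | i ∈ b.support})

/-- `e` is a numbering `α_1, …, α_ℓ` of the simple roots (`α_{i+1}` has index `i : Fin ℓ`) for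
which the Cartan matrix is that of `D_ℓ` in the usual numbering: `α_1, …, α_{ℓ-2}` is a chain and
`α_{ℓ-1}`, `α_ℓ` are both attached to `α_{ℓ-2}`. -/
def IsTypeD {P : RootPairing ι ℝ M N} [P.IsCrystallographic] (b : P.Base) {ℓ : ℕ}
    (e : Fin ℓ ≃ b.support) : Prop :=
  ∀ i j, b.cartanMatrix (e i) (e j) = CartanMatrix.D ℓ i j

end RootSystem

end

end EquivariantQuasi

/-!
In coordinates where `α_i = ε_i - ε_{i+1}` for `i < ℓ` and `α_ℓ = ε_{ℓ-1} + ε_ℓ`, the roots are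
`±ε_k ± ε_l`, and `Z` consists of the vectors whose coordinates are all integers or all half odd
integers. Doubling makes them integers of equal parity, and two points of `Z` agree modulo `qZ` iff
their doubled coordinates modulo `2q` agree or all differ by `q`. So every point of `M(Φ; q)` is
represented by exactly two tuples over `ℤ/2q` of constant parity with entries distinct up to sign,
and twice the character value at a signed permutation counts the tuples which it fixes up to adding
`q` to every entry.

A product of longest elements is recognized as a signed permutation by its effect on the vector
`(ℓ-1, …, 1, 0)`, on which all simple roots take the value `1`: `ω_1` changes the signs of the first
and last coordinates, and for odd `ℓ` the element `ω_ℓ` reverses the order of the coordinates and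
changes the sign of all but the first; `ω_{ℓ-1}` does the same in coordinates adapted to the
numbering with `α_{ℓ-1}` and `α_ℓ` exchanged.

For the counts, `0` and `q` are the only entries equal to their negatives. A tuple fixed by `ω_1`
has `0` and `q` at its ends. So does a tuple fixed by `ω_ℓ`, which moreover satisfies
`y_k + y_{ℓ+1-k} = q` for all `k`: all its entries are even, and twice the middle one is `q`, which
forces `4 ∣ q`. It is determined by its first half, whose inner entries have to be distinct up to
`a ↦ -a` and `a ↦ a + q`.
-/

namespace EquivariantQuasi

section Counting

variable {α β : Type*} [DecidableEq β]

/-- The `n`-tuples in `S` whose entries lie in pairwise different fibres of `f`. -/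
def separatedTuples (f : α → β) (n : ℕ) (S : Finset α) : Finset (Fin n → α) :=
  {y ∈ Fintype.piFinset fun _ => S | Function.Injective (f ∘ y)}

theorem mem_separatedTuples {f : α → β} {n : ℕ} {S : Finset α} {y : Fin n → α} :
    y ∈ separatedTuples f n S ↔ (∀ i, y i ∈ S) ∧ Function.Injective (f ∘ y) := by
  simp only [separatedTuples, Finset.mem_filter, Fintype.mem_piFinset]

@[simp] theorem card_separatedTuples_zero (f : α → β) (S : Finset α) :
    (separatedTuples f 0 S).card = 1 :=
  Finset.card_eq_one.2 ⟨default, Finset.ext fun y => by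
    simp [mem_separatedTuples, Subsingleton.elim y default, Function.injective_of_subsingleton]⟩

theorem cons_mem_separatedTuples {f : α → β} {n : ℕ} {S : Finset α} {a : α} {z : Fin n → α} :
    (Fin.cons a z : Fin (n + 1) → α) ∈ separatedTuples f (n + 1) S ↔
      a ∈ S ∧ z ∈ separatedTuples f n {x ∈ S | f x ≠ f a} := by
  simp only [mem_separatedTuples, Fin.forall_fin_succ, Fin.cons_zero, Fin.cons_succ,
    Fin.comp_cons, Fin.cons_injective_iff, Set.mem_range, Function.comp_apply, not_exists,
    Finset.mem_filter, forall_and]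
  tauto

theorem card_separatedTuples_succ (f : α → β) (n : ℕ) (S : Finset α) :
    (separatedTuples f (n + 1) S).card =
      ∑ a ∈ S, (separatedTuples f n {x ∈ S | f x ≠ f a}).card := by
  rw [← Finset.card_sigma]
  refine Finset.card_bij' (fun y _ => ⟨y 0, Fin.tail y⟩) (fun p _ => Fin.cons p.1 p.2)
    (fun y hy => ?_) (fun p hp => ?_) (fun y _ => Fin.cons_self_tail y) (fun p _ => rfl)
  · rw [← Fin.cons_self_tail y, cons_mem_separatedTuples] at hy
    exact Finset.mem_sigma.2 hy
  · exact cons_mem_separatedTuples.2 (Finset.mem_sigma.1 hp)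

theorem card_separatedTuples_of_card_fiber {f : α → β} {d : ℕ} (n : ℕ) (S : Finset α)
    (hd : ∀ a ∈ S, {x ∈ S | f x = f a}.card = d) :
    ((separatedTuples f n S).card : ℚ) = ∏ i ∈ Finset.range n, ((S.card : ℚ) - d * i) := by
  induction n generalizing S with
  | zero => simp
  | succ n ih =>
    have hstep : ∀ a ∈ S, ((separatedTuples f n {x ∈ S | f x ≠ f a}).card : ℚ) =
        ∏ i ∈ Finset.range n, ((S.card : ℚ) - d * (i + 1 : ℕ)) := fun a ha => by
      have hcard : (({x ∈ S | f x ≠ f a}.card : ℕ) : ℚ) = S.card - d := by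
        rw [← hd a ha, eq_sub_iff_add_eq', ← Nat.cast_add, Finset.card_filter_add_card_filter_not]
      rw [ih, hcard]
      · exact Finset.prod_congr rfl fun i _ => by push_cast; ring
      · intro c hc
        rw [Finset.mem_filter] at hc
        rw [Finset.filter_filter, ← hd c hc.1]
        exact congrArg Finset.card (Finset.filter_congr fun x _ =>
          and_iff_right_of_imp fun hx => hx ▸ hc.2)
    rw [card_separatedTuples_succ, Nat.cast_sum, Finset.sum_congr rfl hstep, Finset.sum_const,
      nsmul_eq_mul, Finset.prod_range_succ', mul_comm]
    simp

theorem card_separatedTuples_insert [DecidableEq α] {f : α → β} (n : ℕ) {s : α} (S : Finset α)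
    (hs : ∀ a ∈ S, f a ≠ f s) :
    (separatedTuples f (n + 1) (insert s S)).card =
      (separatedTuples f (n + 1) S).card + (n + 1) * (separatedTuples f n S).card := by
  have hsplit : ∀ (n : ℕ) (S : Finset α), (∀ a ∈ S, f a ≠ f s) →
      (separatedTuples f (n + 1) (insert s S)).card = (separatedTuples f n S).card +
        ∑ a ∈ S, (separatedTuples f n (insert s {x ∈ S | f x ≠ f a})).card := fun n S hs => by
    rw [card_separatedTuples_succ, Finset.sum_insert fun h => hs s h rfl]
    congr 1
    · rw [Finset.filter_insert, if_neg (not_not.2 rfl), Finset.filter_true_of_mem hs]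
    · exact Finset.sum_congr rfl fun a ha => by
        rw [Finset.filter_insert, if_pos (hs a ha).symm]
  induction n generalizing S with
  | zero => rw [hsplit _ _ hs, card_separatedTuples_succ]; simp [add_comm]
  | succ n ih =>
    have hstep : ∀ a ∈ S, (separatedTuples f (n + 1) (insert s {x ∈ S | f x ≠ f a})).card =
        (separatedTuples f (n + 1) {x ∈ S | f x ≠ f a}).card +
          (n + 1) * (separatedTuples f n {x ∈ S | f x ≠ f a}).card := fun a _ =>
      ih _ fun c hc => hs c (Finset.mem_filter.1 hc).1
    rw [hsplit _ _ hs, Finset.sum_congr rfl hstep, Finset.sum_add_distrib, ← Finset.mul_sum,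
      ← card_separatedTuples_succ, ← card_separatedTuples_succ]
    ring

theorem cons_snoc_comp_injective_iff {γ : Type*} {n : ℕ} {f : α → γ} {a c : α} {z : Fin n → α} :
    Function.Injective (f ∘ (Fin.cons a (Fin.snoc z c : Fin (n + 1) → α) : Fin (n + 2) → α)) ↔
      f a ≠ f c ∧ (∀ i, f (z i) ≠ f a) ∧ (∀ i, f (z i) ≠ f c) ∧ Function.Injective (f ∘ z) := by
  rw [Fin.comp_cons, Fin.comp_snoc, Fin.cons_injective_iff, Fin.snoc_injective_iff]
  simp only [Set.mem_range, Fin.exists_fin_succ', Fin.snoc_castSucc, Fin.snoc_last,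
    Function.comp_apply, not_or, not_exists]
  tauto

theorem natCard_tuples_with_ends {f : α → β} (n : ℕ) {D : Finset (α × α)}
    {S : Finset α} (hD : ∀ p ∈ D, f p.1 ≠ f p.2)
    (hS : ∀ p ∈ D, ∀ s ∈ S, f s ≠ f p.1 ∧ f s ≠ f p.2) :
    Nat.card {y : Fin (n + 2) → α // (y 0, y (Fin.last (n + 1))) ∈ D ∧
        (∀ i : Fin n, y i.castSucc.succ ∈ S) ∧ Function.Injective (f ∘ y)} =
      D.card * (separatedTuples f n S).card := by
  rw [← Finset.card_product, ← Nat.card_eq_finsetCard]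
  have hmem : ∀ (p : α × α) (z : Fin n → α), p ∈ D → (∀ i, z i ∈ S) →
      (Function.Injective (f ∘ (Fin.cons p.1 (Fin.snoc z p.2 : Fin (n + 1) → α) :
        Fin (n + 2) → α)) ↔ Function.Injective (f ∘ z)) := fun p z hp hz => by
    rw [cons_snoc_comp_injective_iff]
    exact ⟨fun h => h.2.2.2, fun h => ⟨hD p hp, fun i => (hS p hp _ (hz i)).1,
      fun i => (hS p hp _ (hz i)).2, h⟩⟩
  have hy : ∀ y : Fin (n + 2) → α, Fin.cons (y 0)
      (Fin.snoc (fun i : Fin n => y i.castSucc.succ) (y (Fin.last (n + 1))) : Fin (n + 1) → α) =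
        y := fun y => by
    rw [show (fun i : Fin n => y i.castSucc.succ) = Fin.init (Fin.tail y) from rfl,
      ← Fin.succ_last, show y (Fin.last n).succ = Fin.tail y (Fin.last n) from rfl,
      Fin.snoc_init_self, Fin.cons_self_tail]
  refine Nat.card_congr
    { toFun := fun y => ⟨((y.1 0, y.1 (Fin.last (n + 1))), fun i => y.1 i.castSucc.succ), ?_⟩
      invFun := fun p => ⟨Fin.cons p.1.1.1 (Fin.snoc p.1.2 p.1.1.2 : Fin (n + 1) → α), ?_⟩
      left_inv := fun y => Subtype.ext (hy y.1)
      right_inv := fun p => ?_ }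
  · obtain ⟨y, hD, hz, hinj⟩ := y
    rw [← hy y, hmem (_, _) _ hD hz] at hinj
    exact Finset.mk_mem_product hD (mem_separatedTuples.2 ⟨hz, hinj⟩)
  · obtain ⟨⟨p, z⟩, h⟩ := p
    obtain ⟨hp, hz⟩ := Finset.mem_product.1 h
    rw [mem_separatedTuples] at hz
    refine ⟨?_, fun i => ?_, (hmem p z hp hz.1).2 hz.2⟩
    · simpa [← Fin.succ_last] using hp
    · simpa using hz.1 i
  · obtain ⟨⟨p, z⟩, h⟩ := p
    simp [← Fin.succ_last]

end Counting

section WordLength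

variable {G : Type*} [Group G] {S : Set G}

theorem wordLength_prod_le {l : List G} (hl : ∀ s ∈ l, s ∈ S) :
    wordLength S l.prod ≤ l.length :=
  Nat.sInf_le ⟨l, hl, rfl, rfl⟩

theorem exists_word_length_eq_wordLength (hS : ∀ s ∈ S, s⁻¹ ∈ S) {w : G}
    (hw : w ∈ Subgroup.closure S) :
    ∃ l : List G, (∀ s ∈ l, s ∈ S) ∧ l.prod = w ∧ l.length = wordLength S w := by
  have hinv : S ∪ S⁻¹ = S := Set.union_eq_self_of_subset_right fun s hs => by
    simpa using hS _ (Set.mem_inv.1 hs)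
  rw [← Subgroup.mem_toSubmonoid, Subgroup.closure_toSubmonoid, hinv] at hw
  obtain ⟨l, hl, hprod⟩ := Submonoid.exists_list_of_mem_closure hw
  have hne : {n | ∃ l : List G, (∀ s ∈ l, s ∈ S) ∧ l.prod = w ∧ l.length = n}.Nonempty :=
    ⟨l.length, l, hl, hprod, rfl⟩
  exact Nat.sInf_mem hne

end WordLength

section WeylGroup

variable {ι M N : Type*} [AddCommGroup M] [Module ℝ M] [AddCommGroup N] [Module ℝ N]
  (P : RootPairing ι ℝ M N)

theorem coweightAction_injective : Function.Injective (coweightAction P) := fun _ _ h =>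
  Subtype.ext <| inv_injective <| RootPairing.Equiv.coweightHom_injective P <|
    congrArg MulOpposite.op h

theorem weylGroupToPerm_ofIdx (i : ι) :
    P.weylGroupToPerm (RootPairing.weylGroup.ofIdx P i) = P.reflectionPerm i :=
  RootPairing.Equiv.reflection_indexEquiv P i

theorem ofIdx_inv (i : ι) :
    (RootPairing.weylGroup.ofIdx P i)⁻¹ = RootPairing.weylGroup.ofIdx P i :=
  Subtype.ext (RootPairing.Equiv.reflection_inv P i)

theorem ofIdx_mul_self (i : ι) :
    RootPairing.weylGroup.ofIdx P i * RootPairing.weylGroup.ofIdx P i = 1 :=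
  mul_eq_one_iff_inv_eq.2 (ofIdx_inv P i)

theorem inv_mem_reflectionsIn {J : Set ι} {s : P.weylGroup} (hs : s ∈ reflectionsIn P J) :
    s⁻¹ ∈ reflectionsIn P J := by
  obtain ⟨i, hi, rfl⟩ := hs
  exact ⟨i, hi, (ofIdx_inv P i).symm⟩

theorem coweightAction_coroot (w : P.weylGroup) (i : ι) :
    coweightAction P w (P.coroot i) = P.coroot (P.weylGroupToPerm w i) := by
  have h : P.weylGroupToPerm w i = (P.weylGroupToPerm w⁻¹).symm i := by rw [map_inv]; rfl
  rw [h]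
  exact RootPairing.Hom.coroot_coweightMap_apply P P i (w⁻¹ : P.weylGroup).1.toHom

theorem mul_ofIdx (w : P.weylGroup) (i : ι) :
    w * RootPairing.weylGroup.ofIdx P i =
      RootPairing.weylGroup.ofIdx P (P.weylGroupToPerm w i) * w := by
  apply coweightAction_injective P
  ext x
  simp only [map_mul, LinearEquiv.mul_apply, coweightAction_ofIdx, map_sub, map_smul,
    coweightAction_coroot, root'_coweightAction, map_inv, Equiv.Perm.coe_inv,
    Equiv.symm_apply_apply]

theorem isLongest_longestElement [Finite ι] [P.IsRootSystem] (S : Set P.weylGroup) :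
    IsLongest S (longestElement S) :=
  have := finite_weylGroup P
  Classical.epsilon_spec (exists_isLongest S)

end WeylGroup

section Descent

variable {ι M N : Type*} [AddCommGroup M] [Module ℝ M] [AddCommGroup N] [Module ℝ N]
  {P : RootPairing ι ℝ M N}

theorem exists_shorter_word [Finite ι] [P.IsCrystallographic] [P.IsReduced] (b : P.Base)
    {J : Set ι} (hJ : J ⊆ b.support) {j : ι} (hj : j ∈ b.support) (l : List P.weylGroup)
    (hl : ∀ s ∈ l, s ∈ reflectionsIn P J) (hneg : ¬ b.IsPos (P.weylGroupToPerm l.prod⁻¹ j)) :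
    ∃ l' : List P.weylGroup, (∀ s ∈ l', s ∈ reflectionsIn P J) ∧ l'.length + 1 = l.length ∧
      RootPairing.weylGroup.ofIdx P j * l.prod = l'.prod := by
  induction l using List.reverseRecOn with
  | nil => exact absurd (RootPairing.Base.isPos_of_mem_support hj) (by simpa using hneg)
  | append_singleton l s ih =>
    rw [List.forall_mem_append, List.forall_mem_singleton] at hl
    obtain ⟨hl, i, hi, rfl⟩ := hl
    rw [List.prod_append, List.prod_singleton] at hneg ⊢
    by_cases hpos : b.IsPos (P.weylGroupToPerm l.prod⁻¹ j)
    · have hji : P.weylGroupToPerm l.prod⁻¹ j = i := by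
        by_contra hne
        refine hneg ?_
        rw [mul_inv_rev, ofIdx_inv, map_mul, Equiv.Perm.mul_apply, weylGroupToPerm_ofIdx]
        exact hpos.reflectionPerm (hJ hi) hne
      refine ⟨l, hl, by simp, ?_⟩
      have hj : P.weylGroupToPerm l.prod i = j := by
        rw [← hji, map_inv, Equiv.Perm.coe_inv, Equiv.apply_symm_apply]
      rw [mul_ofIdx, hj, ← mul_assoc, ofIdx_mul_self, one_mul]
    · obtain ⟨l', hl', hlen, hprod⟩ := ih hl hpos
      refine ⟨l' ++ [RootPairing.weylGroup.ofIdx P i], ?_, by simpa using hlen, ?_⟩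
      · rw [List.forall_mem_append, List.forall_mem_singleton]
        exact ⟨hl', i, hi, rfl⟩
      · rw [← mul_assoc, hprod, List.prod_append, List.prod_singleton]

theorem wordLength_ofIdx_mul_lt [Finite ι] [P.IsCrystallographic] [P.IsReduced] (b : P.Base)
    {J : Set ι} (hJ : J ⊆ b.support) {j : ι} (hj : j ∈ b.support) {w : P.weylGroup}
    (hw : w ∈ Subgroup.closure (reflectionsIn P J))
    (hneg : ¬ b.IsPos (P.weylGroupToPerm w⁻¹ j)) :
    wordLength (reflectionsIn P J) (RootPairing.weylGroup.ofIdx P j * w) <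
      wordLength (reflectionsIn P J) w := by
  obtain ⟨l, hl, rfl, hlen⟩ :=
    exists_word_length_eq_wordLength (fun _ => inv_mem_reflectionsIn P) hw
  obtain ⟨l', hl', hlen', hprod⟩ := exists_shorter_word b hJ hj l hl hneg
  rw [← hlen, ← hlen', hprod]
  exact Nat.lt_succ_of_le (wordLength_prod_le hl')

theorem not_isPos_of_isLongest [Finite ι] [P.IsCrystallographic] [P.IsReduced] (b : P.Base)
    {J : Set ι} (hJ : J ⊆ b.support) {w : P.weylGroup} (hw : IsLongest (reflectionsIn P J) w)
    {j : ι} (hj : j ∈ J) : ¬ b.IsPos (P.weylGroupToPerm w⁻¹ j) := fun hpos => by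
  set s := RootPairing.weylGroup.ofIdx P j
  have hsw : s * w ∈ Subgroup.closure (reflectionsIn P J) :=
    mul_mem (Subgroup.subset_closure ⟨j, hj, rfl⟩) hw.1
  have hneg : ¬ b.IsPos (P.weylGroupToPerm (s * w)⁻¹ j) := by
    rw [mul_inv_rev, ofIdx_inv, mul_ofIdx, map_mul, weylGroupToPerm_ofIdx, Equiv.Perm.mul_apply]
    exact fun h => (RootPairing.Base.IsPos.neg_iff_not b _).1 h hpos
  have hlt := wordLength_ofIdx_mul_lt b hJ (hJ hj) hsw hneg
  rw [← mul_assoc, ofIdx_mul_self, one_mul] at hlt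
  exact hlt.not_ge (hw.2 _ hsw)

theorem root'_eq_height (b : P.Base) {δ : N} (hδ : ∀ i ∈ b.support, P.root' i δ = 1) (i : ι) :
    P.root' i δ = b.height i := by
  obtain ⟨f, -, -, hf⟩ := b.exists_root_eq_sum_int i
  have hroot : ∀ j, P.root' j δ = P.toLinearMap (P.root j) δ := fun j => rfl
  rw [RootPairing.Base.height_eq_sum hf, hroot, hf, map_sum, LinearMap.sum_apply, Int.cast_sum]
  refine Finset.sum_congr rfl fun j hj => ?_
  rw [map_zsmul, LinearMap.smul_apply, ← hroot, hδ j hj, zsmul_one]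

theorem root'_longestElement_neg [Finite ι] [P.IsRootSystem] [P.IsCrystallographic] [P.IsReduced]
    (b : P.Base) {J : Set ι} (hJ : J ⊆ b.support) {δ : N}
    (hδ : ∀ i ∈ b.support, P.root' i δ = 1) {j : ι} (hj : j ∈ J) :
    P.root' j (coweightAction P (longestElement (reflectionsIn P J)) δ) < 0 := by
  have hneg := not_isPos_of_isLongest b hJ (isLongest_longestElement P _) hj
  rw [RootPairing.Base.isPos_iff] at hneg
  rw [root'_coweightAction, root'_eq_height b hδ, Int.cast_lt_zero]
  exact (not_lt.1 hneg).lt_of_ne (b.height_ne_zero _)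

end Descent

section Coordinates

variable {n : ℕ}

/-- The simple roots `e₁ - e₂, …, e_{ℓ-1} - e_ℓ, e_{ℓ-1} + e_ℓ` of type `D_ℓ`, `ℓ = n + 2`, in the
standard coordinates. -/
def simpleRoot (n : ℕ) : Fin (n + 2) → Fin (n + 2) → ℝ :=
  Fin.lastCases (Pi.single (Fin.last n).castSucc 1 + Pi.single (Fin.last (n + 1)) 1)
    fun i => Pi.single i.castSucc 1 - Pi.single i.succ 1

theorem simpleRoot_castSucc (i : Fin (n + 1)) :
    simpleRoot n i.castSucc = Pi.single i.castSucc 1 - Pi.single i.succ 1 :=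
  Fin.lastCases_castSucc i

theorem simpleRoot_last :
    simpleRoot n (Fin.last (n + 1)) =
      Pi.single (Fin.last n).castSucc 1 + Pi.single (Fin.last (n + 1)) 1 :=
  Fin.lastCases_last

@[simp] theorem simpleRoot_castSucc_dotProduct (v : Fin (n + 2) → ℝ) (i : Fin (n + 1)) :
    simpleRoot n i.castSucc ⬝ᵥ v = v i.castSucc - v i.succ := by
  rw [simpleRoot_castSucc, sub_dotProduct, single_one_dotProduct, single_one_dotProduct]

@[simp] theorem simpleRoot_last_dotProduct (v : Fin (n + 2) → ℝ) :
    simpleRoot n (Fin.last (n + 1)) ⬝ᵥ v = v (Fin.last n).castSucc + v (Fin.last (n + 1)) := by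
  rw [simpleRoot_last, add_dotProduct, single_one_dotProduct, single_one_dotProduct]

theorem simpleRoot_dotProduct_simpleRoot (hn : n ≠ 0) (i j : Fin (n + 2)) :
    simpleRoot n i ⬝ᵥ simpleRoot n j = CartanMatrix.D (n + 2) i j := by
  have hn2 : ¬ n + 2 ≤ 2 := by omega
  refine Fin.lastCases ?_ (fun i => ?_) i <;> refine Fin.lastCases ?_ (fun j => ?_) j <;>
    simp only [simpleRoot_castSucc_dotProduct, simpleRoot_last_dotProduct] <;>
    simp only [simpleRoot_castSucc, simpleRoot_last, Pi.add_apply, Pi.sub_apply, Pi.single_apply,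
      CartanMatrix.D, Matrix.of_apply, hn2, if_false, Fin.ext_iff, Fin.val_castSucc, Fin.val_succ,
      Fin.val_last, or_true, and_true]
  · norm_num
  all_goals split_ifs <;> first | omega | norm_num

theorem linearIndependent_simpleRoot : LinearIndependent ℝ (simpleRoot n) := by
  change LinearIndependent ℝ (Matrix.of (simpleRoot n)).row
  rw [Matrix.linearIndependent_rows_iff_isUnit, ← Matrix.mulVec_injective_iff_isUnit,
    ← Matrix.coe_mulVecLin, injective_iff_map_eq_zero]
  intro v hv
  have hroot : ∀ i, simpleRoot n i ⬝ᵥ v = 0 := fun i => congrFun hv i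
  have hconst : ∀ i, v i = v 0 := Fin.induction rfl fun i ih => by
    have h := hroot i.castSucc
    rw [simpleRoot_castSucc_dotProduct, ih] at h
    linarith
  have hlast := hroot (Fin.last (n + 1))
  rw [simpleRoot_last_dotProduct, hconst, hconst (Fin.last _)] at hlast
  ext i
  rw [hconst, Pi.zero_apply]
  linarith

variable {ι M N : Type*} [AddCommGroup M] [Module ℝ M] [AddCommGroup N] [Module ℝ N]
  {P : RootPairing ι ℝ M N}

/-- `φ` is a system of orthonormal coordinates for a root system of type `D`: the simple roots and
the simple coroots are both given by `simpleRoot`. -/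
structure IsStandard (b : P.Base) (e : Fin (n + 2) ≃ b.support)
    (φ : N ≃ₗ[ℝ] (Fin (n + 2) → ℝ)) : Prop where
  root : ∀ i x, P.root' (e i) x = simpleRoot n i ⬝ᵥ φ x
  coroot : ∀ i, φ (P.coroot (e i)) = simpleRoot n i

theorem exists_isStandard (hn : n ≠ 0) [P.IsRootSystem] [P.IsCrystallographic] {b : P.Base}
    {e : Fin (n + 2) ≃ b.support} (hD : IsTypeD b e) : ∃ φ, IsStandard b e φ := by
  let coroots := b.toCoweightBasis.reindex e.symm
  let φ := coroots.equiv (basisOfLinearIndependentOfCardEqFinrank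
    (linearIndependent_simpleRoot (n := n)) (by simp)) (Equiv.refl _)
  have hcoroots : ∀ i, coroots i = P.coroot (e i) := fun i => by simp [coroots]
  have hφ : ∀ i, φ (coroots i) = simpleRoot n i := fun i => by simp [φ]
  refine ⟨φ, fun i x => ?_, fun i => by rw [← hcoroots, hφ]⟩
  suffices P.root' (e i) = (dotProductBilin ℝ ℝ (simpleRoot n i)).comp φ.toLinearMap from
    LinearMap.congr_fun this x
  refine coroots.ext fun j => ?_
  rw [LinearMap.comp_apply, LinearEquiv.coe_coe, hφ, hcoroots]
  have hcartan := RootPairing.Base.algebraMap_cartanMatrixIn_apply ℤ b (e i) (e j)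
  rw [show b.cartanMatrixIn ℤ (e i) (e j) = _ from hD i j] at hcartan
  exact hcartan.symm.trans (simpleRoot_dotProduct_simpleRoot hn i j).symm

theorem IsTypeD.swap [P.IsCrystallographic] {b : P.Base} {e : Fin (n + 2) ≃ b.support}
    (hD : IsTypeD b e) :
    IsTypeD b ((Equiv.swap (Fin.last n).castSucc (Fin.last (n + 1))).trans e) := by
  intro i j
  have hswap : ∀ i : Fin (n + 2), ∃ k : ℕ,
      (Equiv.swap (Fin.last n).castSucc (Fin.last (n + 1)) i).val = k ∧
        (i.val < n ∧ k = i.val ∨ i.val = n ∧ k = n + 1 ∨ i.val = n + 1 ∧ k = n) := fun i => by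
    refine ⟨_, rfl, ?_⟩
    have := i.2
    rw [Equiv.swap_apply_def]
    simp only [Fin.ext_iff, Fin.val_castSucc, Fin.val_last, apply_ite Fin.val]
    split_ifs <;> omega
  obtain ⟨k, hk, hik⟩ := hswap i
  obtain ⟨m, hm, hjm⟩ := hswap j
  rw [Equiv.trans_apply, Equiv.trans_apply, hD]
  simp only [CartanMatrix.D, Matrix.of_apply, Fin.ext_iff, hk, hm]
  exact if_congr (by omega) rfl <| if_congr Iff.rfl rfl <| if_congr (by omega) rfl <|
    if_congr (by omega) rfl <| if_congr (by omega) rfl <| if_congr (by omega) rfl rfl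

end Coordinates

section SignedPermutations

variable {n : ℕ}

theorem perm_eq_one_of_strictMono {m : ℕ} {σ : Equiv.Perm (Fin m)} (hσ : StrictMono σ) :
    σ = 1 :=
  Equiv.ext <| congrFun <| (StrictMono.range_inj hσ strictMono_id).1 <| by
    rw [σ.surjective.range_eq, Set.range_id]

theorem perm_eq_revPerm_of_strictAnti {m : ℕ} {σ : Equiv.Perm (Fin m)} (hσ : StrictAnti σ) :
    σ = Fin.revPerm := by
  have h : σ * Fin.revPerm = 1 := perm_eq_one_of_strictMono fun i j hij =>
    hσ (Fin.rev_lt_rev.2 hij)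
  rw [mul_eq_one_iff_eq_inv.1 h]
  rfl

theorem abs_succ_lt_neg_castSucc {y : Fin (n + 2) → ℝ} {m : ℕ}
    (hchain : ∀ i : Fin (n + 1), m ≤ i → y i.castSucc < y i.succ)
    (hfork : y (Fin.last n).castSucc + y (Fin.last (n + 1)) < 0) (i : Fin (n + 1)) :
    m ≤ i → |y i.succ| < -y i.castSucc := by
  induction i using Fin.reverseInduction with
  | last =>
    intro hm
    rw [abs_lt, neg_neg]
    exact ⟨hchain _ hm, by rw [Fin.succ_last]; linarith⟩
  | cast i ih =>
    intro hm
    have hneg : y i.succ.castSucc < 0 :=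
      neg_pos.1 ((abs_nonneg _).trans_lt (ih (by simpa using Nat.le_succ_of_le hm)))
    rw [Fin.succ_castSucc, abs_of_neg hneg, neg_lt_neg_iff, ← Fin.succ_castSucc]
    exact hchain _ hm

theorem signedPerm_of_antidominant {σ : Equiv.Perm (Fin (n + 2))} {ε : Fin (n + 2) → ℤˣ}
    {y : Fin (n + 2) → ℝ} (hy : ∀ k, y k = ((ε k : ℤ) : ℝ) * ((n : ℝ) + 1 - (σ k).val)) {m : ℕ}
    (hchain : ∀ i : Fin (n + 1), m ≤ i → y i.castSucc < y i.succ)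
    (hfork : y (Fin.last n).castSucc + y (Fin.last (n + 1)) < 0) {i : Fin (n + 1)} (hi : m ≤ i) :
    σ i.castSucc < σ i.succ ∧ ε i.castSucc = -1 := by
  have hnonneg : ∀ k, 0 ≤ (n : ℝ) + 1 - (σ k).val := fun k => by
    rw [sub_nonneg]
    exact_mod_cast Nat.le_of_lt_succ (σ k).2
  have habs : ∀ k, |y k| = (n : ℝ) + 1 - (σ k).val := fun k => by
    rw [hy, abs_mul, abs_of_nonneg (hnonneg k)]
    rcases Int.units_eq_one_or (ε k) with h | h <;> simp [h]
  have hlt := abs_succ_lt_neg_castSucc hchain hfork i hi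
  constructor
  · have h := hlt.trans_le (neg_le_abs _)
    rw [habs, habs, sub_lt_sub_iff_left, Nat.cast_lt] at h
    exact h
  · refine (Int.units_eq_one_or _).resolve_left fun hε => ?_
    have h := (abs_nonneg _).trans_lt hlt
    rw [hy, hε, Units.val_one, Int.cast_one, one_mul] at h
    exact (neg_pos.1 h).not_ge (hnonneg _)

theorem sign_last_eq_prod {ε : Fin (n + 2) → ℤˣ} (hε : ∏ k, ε k = 1) :
    ε (Fin.last (n + 1)) = ∏ i : Fin (n + 1), ε i.castSucc := by
  rw [Fin.prod_univ_castSucc, mul_eq_one_iff_eq_inv', Int.units_inv_eq_self] at hε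
  exact hε

theorem prod_signs_mul_comp (σ : Equiv.Perm (Fin n)) {ε η : Fin n → ℤˣ}
    (hε : ∏ k, ε k = 1) (hη : ∏ k, η k = 1) : ∏ k, ε k * η (σ k) = 1 := by
  rw [Finset.prod_mul_distrib, hε, Equiv.prod_comp σ η, hη, one_mul]

theorem prod_signs_last_two :
    ∏ k : Fin (n + 2), (if k = (Fin.last n).castSucc ∨ k = Fin.last (n + 1) then
      (-1 : ℤˣ) else 1) = 1 := by
  rw [Fin.prod_univ_castSucc, Fin.prod_univ_castSucc, Finset.prod_eq_one]
  · simp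
  · exact fun i _ => if_neg <| by simp [Fin.castSucc_ne_last]

variable {ι M N : Type*} [AddCommGroup M] [Module ℝ M] [AddCommGroup N] [Module ℝ N]
  {P : RootPairing ι ℝ M N} {φ : N ≃ₗ[ℝ] (Fin (n + 2) → ℝ)}

/-- `w` acts in the coordinates `φ` by the signed permutation `(w x)_k = ε_k x_{σ k}`. -/
def ActsBy (φ : N ≃ₗ[ℝ] (Fin (n + 2) → ℝ)) (w : P.weylGroup) (σ : Equiv.Perm (Fin (n + 2)))
    (ε : Fin (n + 2) → ℤˣ) : Prop :=
  ∀ x k, φ (coweightAction P w x) k = ((ε k : ℤ) : ℝ) * φ x (σ k)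

theorem actsBy_one : ActsBy φ (1 : P.weylGroup) 1 1 := fun x k => by simp

theorem ActsBy.mul {v w : P.weylGroup} {σ τ : Equiv.Perm (Fin (n + 2))}
    {ε η : Fin (n + 2) → ℤˣ} (hv : ActsBy φ v σ ε) (hw : ActsBy φ w τ η) :
    ActsBy φ (v * w) (τ * σ) (fun k => ε k * η (σ k)) := fun x k => by
  rw [map_mul, LinearEquiv.mul_apply, hv, hw, Units.val_mul, Int.cast_mul, mul_assoc,
    Equiv.Perm.mul_apply]

theorem ActsBy.unique {v w : P.weylGroup} {σ : Equiv.Perm (Fin (n + 2))}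
    {ε : Fin (n + 2) → ℤˣ} (hv : ActsBy φ v σ ε) (hw : ActsBy φ w σ ε) : v = w := by
  apply coweightAction_injective P
  ext x
  apply φ.injective
  ext k
  rw [hv, hw]

theorem exists_actsBy_of_mem_closure
    (C : Equiv.Perm (Fin (n + 2)) → (Fin (n + 2) → ℤˣ) → Prop) (hone : C 1 1)
    (hmul : ∀ σ τ ε η, C σ ε → C τ η → C (τ * σ) (fun k => ε k * η (σ k))) {J : Set ι}
    (hgen : ∀ i ∈ J, ∃ σ ε, ActsBy φ (RootPairing.weylGroup.ofIdx P i) σ ε ∧ C σ ε)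
    {w : P.weylGroup} (hw : w ∈ Subgroup.closure (reflectionsIn P J)) :
    ∃ σ ε, ActsBy φ w σ ε ∧ C σ ε := by
  obtain ⟨l, hl, rfl, -⟩ :=
    exists_word_length_eq_wordLength (fun _ => inv_mem_reflectionsIn P) hw
  clear hw
  induction l with
  | nil => exact ⟨1, 1, actsBy_one, hone⟩
  | cons s l ih =>
    rw [List.forall_mem_cons] at hl
    obtain ⟨⟨i, hi, rfl⟩, hl⟩ := hl
    obtain ⟨σ, ε, hs, hC⟩ := hgen i hi
    obtain ⟨τ, η, hprod, hC'⟩ := ih hl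
    exact ⟨_, _, hs.mul hprod, hmul _ _ _ _ hC hC'⟩

variable {b : P.Base} {e : Fin (n + 2) ≃ b.support}

theorem forall_mem_support_iff (e : Fin (n + 2) ≃ b.support) {p : ι → Prop} :
    (∀ i ∈ b.support, p i) ↔ ∀ k, p (e k) :=
  ⟨fun h k => h _ (e k).2, fun h i hi => by simpa using h (e.symm ⟨i, hi⟩)⟩

theorem IsStandard.actsBy_castSucc (h : IsStandard b e φ) (i : Fin (n + 1)) :
    ActsBy φ (RootPairing.weylGroup.ofIdx P (e i.castSucc))
      (Equiv.swap i.castSucc i.succ) 1 := fun x k => by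
  have hne : i.castSucc ≠ i.succ := Fin.castSucc_lt_succ.ne
  rw [coweightAction_ofIdx, map_sub, map_smul, h.root, h.coroot, simpleRoot_castSucc_dotProduct,
    simpleRoot_castSucc]
  simp only [Pi.sub_apply, Pi.smul_apply, Pi.single_apply, smul_eq_mul, Pi.one_apply,
    Units.val_one, Int.cast_one, one_mul, Equiv.swap_apply_def]
  split_ifs with h1 h2 h2
  · exact absurd (h1.symm.trans h2) hne
  · subst h1; ring
  · subst h2; ring
  · ring

theorem IsStandard.actsBy_last (h : IsStandard b e φ) :
    ActsBy φ (RootPairing.weylGroup.ofIdx P (e (Fin.last (n + 1))))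
      (Equiv.swap (Fin.last n).castSucc (Fin.last (n + 1)))
      (fun k => if k = (Fin.last n).castSucc ∨ k = Fin.last (n + 1) then -1 else 1) :=
    fun x k => by
  have hne : (Fin.last n).castSucc ≠ Fin.last (n + 1) := Fin.castSucc_ne_last _
  rw [coweightAction_ofIdx, map_sub, map_smul, h.root, h.coroot, simpleRoot_last_dotProduct,
    simpleRoot_last]
  simp only [Pi.sub_apply, Pi.add_apply, Pi.smul_apply, Pi.single_apply, smul_eq_mul,
    Equiv.swap_apply_def]
  by_cases h1 : k = (Fin.last n).castSucc
  · subst h1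
    simp [hne]
  · by_cases h2 : k = Fin.last (n + 1)
    · subst h2
      simp [hne.symm]
    · simp [h1, h2]

theorem IsStandard.exists_actsBy_even (h : IsStandard b e φ) {w : P.weylGroup}
    (hw : w ∈ Subgroup.closure (reflectionsIn P {i | i ∈ b.support})) :
    ∃ σ ε, ActsBy φ w σ ε ∧ ∏ k, ε k = 1 := by
  refine exists_actsBy_of_mem_closure (fun _ ε => ∏ k, ε k = 1) Finset.prod_const_one
    (fun σ _ _ _ => prod_signs_mul_comp σ) ((forall_mem_support_iff e).2 fun k => ?_) hw
  cases k using Fin.lastCases with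
  | last => exact ⟨_, _, h.actsBy_last, prod_signs_last_two⟩
  | cast i => exact ⟨_, _, h.actsBy_castSucc i, Finset.prod_const_one⟩

theorem IsStandard.exists_actsBy_fix_zero (h : IsStandard b e φ) (hn : n ≠ 0) {w : P.weylGroup}
    (hw : w ∈ Subgroup.closure (reflectionsIn P {i | i ∈ b.support ∧ i ≠ e 0})) :
    ∃ σ ε, ActsBy φ w σ ε ∧ ∏ k, ε k = 1 ∧ σ 0 = 0 ∧ ε 0 = 1 := by
  have hgen : ∀ i ∈ b.support, i ≠ e 0 → ∃ σ ε,
      ActsBy φ (RootPairing.weylGroup.ofIdx P i) σ ε ∧ ∏ k, ε k = 1 ∧ σ 0 = 0 ∧ ε 0 = 1 := by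
    refine (forall_mem_support_iff e).2 fun k hk => ?_
    cases k using Fin.lastCases with
    | last =>
      have h0 : (0 : Fin (n + 2)) ≠ (Fin.last n).castSucc := by simp [Fin.ext_iff, hn.symm]
      have h0' : (0 : Fin (n + 2)) ≠ Fin.last (n + 1) := Fin.last_pos.ne
      exact ⟨_, _, h.actsBy_last, prod_signs_last_two, Equiv.swap_apply_of_ne_of_ne h0 h0',
        if_neg (not_or.2 ⟨h0, h0'⟩)⟩
    | cast i =>
      have h0 : 0 ≠ i.castSucc := fun h0 => hk (by rw [h0])
      exact ⟨_, _, h.actsBy_castSucc i, Finset.prod_const_one,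
        Equiv.swap_apply_of_ne_of_ne h0 (Fin.succ_ne_zero i).symm, rfl⟩
  refine exists_actsBy_of_mem_closure (fun σ ε => ∏ k, ε k = 1 ∧ σ 0 = 0 ∧ ε 0 = 1) (by simp) ?_
    (fun i hi => hgen i hi.1 hi.2) hw
  rintro σ τ ε η ⟨hε, hσ0, hε0⟩ ⟨hη, hτ0, hη0⟩
  exact ⟨prod_signs_mul_comp σ hε hη, by simp [hσ0, hτ0], by simp [hσ0, hε0, hη0]⟩

theorem IsStandard.exists_actsBy_perm (h : IsStandard b e φ) {w : P.weylGroup}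
    (hw : w ∈ Subgroup.closure
      (reflectionsIn P {i | i ∈ b.support ∧ i ≠ e (Fin.last (n + 1))})) :
    ∃ σ, ActsBy φ w σ 1 := by
  have hgen : ∀ i ∈ b.support, i ≠ e (Fin.last (n + 1)) → ∃ σ ε,
      ActsBy φ (RootPairing.weylGroup.ofIdx P i) σ ε ∧ ε = 1 := by
    refine (forall_mem_support_iff e).2 fun k hk => ?_
    cases k using Fin.lastCases with
    | last => exact absurd rfl hk
    | cast i => exact ⟨_, _, h.actsBy_castSucc i, rfl⟩
  obtain ⟨σ, _, hw, rfl⟩ := exists_actsBy_of_mem_closure (φ := φ) (fun _ ε => ε = 1) rfl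
    (by rintro _ _ _ _ rfl rfl; exact funext fun _ => mul_one 1)
    (fun i hi => hgen i hi.1 hi.2) hw
  exact ⟨σ, hw⟩

/-- The vector with coordinates `(ℓ - 1, …, 1, 0)`, on which all simple roots take the value
`1`. -/
def weylVector (φ : N ≃ₗ[ℝ] (Fin (n + 2) → ℝ)) : N :=
  φ.symm fun k => (n : ℝ) + 1 - k.val

theorem IsStandard.root'_weylVector (h : IsStandard b e φ) :
    ∀ i ∈ b.support, P.root' i (weylVector φ) = 1 :=
  (forall_mem_support_iff e).2 fun k => by
    rw [h.root, weylVector, LinearEquiv.apply_symm_apply]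
    cases k using Fin.lastCases <;> simp

theorem ActsBy.apply_weylVector {w : P.weylGroup} {σ : Equiv.Perm (Fin (n + 2))}
    {ε : Fin (n + 2) → ℤˣ} (hw : ActsBy φ w σ ε) (k : Fin (n + 2)) :
    φ (coweightAction P w (weylVector φ)) k =
      ((ε k : ℤ) : ℝ) * ((n : ℝ) + 1 - (σ k).val) := by
  rw [hw, weylVector, LinearEquiv.apply_symm_apply]

theorem coe_ne_coe_iff (e : Fin (n + 2) ≃ b.support) {k l : Fin (n + 2)} :
    (e k : ι) ≠ e l ↔ k ≠ l :=
  (Subtype.val_injective.comp e.injective).ne_iff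

section Longest

variable [Finite ι] [P.IsRootSystem] [P.IsCrystallographic] [P.IsReduced]

theorem IsStandard.longestElement_weylVector_lt (h : IsStandard b e φ) {J : Set ι}
    (hJ : J ⊆ b.support) {i : Fin (n + 1)} (hi : (e i.castSucc : ι) ∈ J) :
    φ (coweightAction P (longestElement (reflectionsIn P J)) (weylVector φ)) i.castSucc <
      φ (coweightAction P (longestElement (reflectionsIn P J)) (weylVector φ)) i.succ := by
  rw [← sub_neg, ← simpleRoot_castSucc_dotProduct, ← h.root]
  exact root'_longestElement_neg b hJ h.root'_weylVector hi

theorem IsStandard.longestElement_weylVector_add_lt (h : IsStandard b e φ) {J : Set ι}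
    (hJ : J ⊆ b.support) (hlast : (e (Fin.last (n + 1)) : ι) ∈ J) :
    φ (coweightAction P (longestElement (reflectionsIn P J)) (weylVector φ))
        (Fin.last n).castSucc +
      φ (coweightAction P (longestElement (reflectionsIn P J)) (weylVector φ))
        (Fin.last (n + 1)) < 0 := by
  rw [← simpleRoot_last_dotProduct, ← h.root]
  exact root'_longestElement_neg b hJ h.root'_weylVector hlast

theorem IsStandard.actsBy_longest (h : IsStandard b e φ) :
    ActsBy φ (longestElement (reflectionsIn P {i | i ∈ b.support})) 1
      (fun k => if k = Fin.last (n + 1) then (-1) ^ (n + 1) else -1) := by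
  obtain ⟨σ, ε, hw, hε⟩ := h.exists_actsBy_even (isLongest_longestElement P _).1
  have hJ : {i | i ∈ b.support} ⊆ (b.support : Set ι) := fun _ hi => hi
  have hanti : ∀ i : Fin (n + 1), σ i.castSucc < σ i.succ ∧ ε i.castSucc = -1 := fun i =>
    signedPerm_of_antidominant hw.apply_weylVector
      (fun i _ => h.longestElement_weylVector_lt hJ (e _).2)
      (h.longestElement_weylVector_add_lt hJ (e _).2) (Nat.zero_le i)
  obtain rfl : σ = 1 :=
    perm_eq_one_of_strictMono (Fin.strictMono_iff_lt_succ.2 fun i => (hanti i).1)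
  convert! hw using 1
  ext k : 1
  cases k using Fin.lastCases with
  | last => simp [sign_last_eq_prod hε, hanti]
  | cast i => simp [hanti, Fin.castSucc_ne_last]

theorem IsStandard.actsBy_longest_ne_zero (h : IsStandard b e φ) (hn : n ≠ 0) :
    ActsBy φ (longestElement (reflectionsIn P {i | i ∈ b.support ∧ i ≠ e 0})) 1
      (fun k => if k = 0 then 1 else if k = Fin.last (n + 1) then (-1) ^ n else -1) := by
  obtain ⟨σ, ε, hw, hε, hσ0, hε0⟩ :=
    h.exists_actsBy_fix_zero hn (isLongest_longestElement P _).1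
  have hJ : {i | i ∈ b.support ∧ i ≠ e 0} ⊆ (b.support : Set ι) := fun _ hi => hi.1
  have hanti : ∀ i : Fin (n + 1), 1 ≤ i.val → σ i.castSucc < σ i.succ ∧ ε i.castSucc = -1 :=
    fun i => signedPerm_of_antidominant hw.apply_weylVector
      (fun i hi => h.longestElement_weylVector_lt hJ
        ⟨(e _).2, (coe_ne_coe_iff e).2 (Fin.ne_of_gt hi)⟩)
      (h.longestElement_weylVector_add_lt hJ
        ⟨(e _).2, (coe_ne_coe_iff e).2 Fin.last_pos.ne'⟩)
  have hσ : ∀ i : Fin (n + 1), σ i.castSucc < σ i.succ := fun i => by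
    rcases Nat.eq_zero_or_pos i.val with hi | hi
    · obtain rfl : i = 0 := Fin.ext hi
      rw [Fin.castSucc_zero, hσ0, Fin.pos_iff_ne_zero, ← hσ0]
      exact σ.injective.ne (Fin.succ_ne_zero _)
    · exact (hanti i hi).1
  obtain rfl : σ = 1 := perm_eq_one_of_strictMono (Fin.strictMono_iff_lt_succ.2 hσ)
  have hsign : ∀ i : Fin n, ε i.castSucc.succ = -1 := fun i => (hanti i.succ (by simp)).2
  convert! hw using 1
  ext k : 1
  cases k using Fin.lastCases with
  | last => simp [sign_last_eq_prod hε, Fin.prod_univ_succ, hε0, hsign]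
  | cast i => cases i using Fin.cases <;> simp [hε0, hsign, Fin.castSucc_ne_last]

theorem IsStandard.actsBy_longest_ne_last (h : IsStandard b e φ) :
    ActsBy φ (longestElement (reflectionsIn P {i | i ∈ b.support ∧ i ≠ e (Fin.last (n + 1))}))
      Fin.revPerm 1 := by
  obtain ⟨σ, hw⟩ := h.exists_actsBy_perm (isLongest_longestElement P _).1
  have hσ : ∀ i : Fin (n + 1), σ i.succ < σ i.castSucc := fun i => by
    have hlt := h.longestElement_weylVector_lt
      (J := {i | i ∈ b.support ∧ i ≠ e (Fin.last (n + 1))}) (fun _ hi => hi.1)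
      ⟨(e i.castSucc).2, (coe_ne_coe_iff e).2 (Fin.castSucc_ne_last i)⟩
    simpa [hw.apply_weylVector] using hlt
  rwa [← perm_eq_revPerm_of_strictAnti (Fin.strictAnti_iff_succ_lt.2 hσ)]

theorem IsStandard.actsBy_omega_zero (h : IsStandard b e φ) (hn : n ≠ 0) :
    ActsBy φ (omega b (e 0)) 1 (fun k => if k = 0 ∨ k = Fin.last (n + 1) then -1 else 1) := by
  convert! (h.actsBy_longest_ne_zero hn).mul h.actsBy_longest using 1
  ext k : 1
  cases k using Fin.lastCases with
  | last => simp [← pow_add]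
  | cast i => cases i using Fin.cases <;> simp [Fin.castSucc_ne_last]

theorem IsStandard.actsBy_omega_last (h : IsStandard b e φ) :
    ActsBy φ (omega b (e (Fin.last (n + 1)))) Fin.revPerm
      (fun k => if k = 0 then (-1) ^ (n + 1) else -1) := by
  convert! h.actsBy_longest_ne_last.mul h.actsBy_longest using 1
  ext k : 1
  simp [Fin.rev_eq_iff]

end Longest
end SignedPermutations

section Roots

variable {n : ℕ} {ι M N : Type*} [AddCommGroup M] [Module ℝ M] [AddCommGroup N] [Module ℝ N]
  {P : RootPairing ι ℝ M N} {b : P.Base} {e : Fin (n + 2) ≃ b.support}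
  {φ : N ≃ₗ[ℝ] (Fin (n + 2) → ℝ)}

theorem root'_reflectionPerm (i j : ι) (x : N) :
    P.root' (P.reflectionPerm j i) x =
      P.root' i (coweightAction P (RootPairing.weylGroup.ofIdx P j) x) := by
  rw [root'_coweightAction, ofIdx_inv, weylGroupToPerm_ofIdx]

theorem root'_reflectionPerm_self (i : ι) (x : N) :
    P.root' (P.reflectionPerm i i) x = -P.root' i x := by
  rw [root'_reflectionPerm, coweightAction_ofIdx, map_sub, map_smul,
    RootPairing.root'_coroot_eq_pairing, RootPairing.pairing_same, smul_eq_mul]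
  ring

theorem IsStandard.exists_actsBy_of_perm (h : IsStandard b e φ) (σ : Equiv.Perm (Fin (n + 2))) :
    ∃ w : P.weylGroup, ActsBy φ w σ 1 := by
  have hσ : σ ∈ Submonoid.closure
      (Set.range fun i : Fin (n + 1) => Equiv.swap i.castSucc i.succ) := by
    rw [Equiv.Perm.mclosure_swap_castSucc_succ]
    trivial
  induction hσ using Submonoid.closure_induction with
  | mem _ hs =>
    obtain ⟨i, rfl⟩ := hs
    exact ⟨_, h.actsBy_castSucc i⟩
  | one => exact ⟨1, actsBy_one⟩
  | mul σ τ _ _ hσ hτ =>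
    obtain ⟨v, hv⟩ := hσ
    obtain ⟨w, hw⟩ := hτ
    exact ⟨w * v, by simpa [Pi.one_def] using hw.mul hv⟩

theorem IsStandard.exists_actsBy_of_pair (h : IsStandard b e φ) {i j k l : Fin (n + 2)}
    (hij : i ≠ j) (hkl : k ≠ l) :
    ∃ (w : P.weylGroup) (σ : Equiv.Perm (Fin (n + 2))), ActsBy φ w σ 1 ∧ σ i = k ∧ σ j = l := by
  obtain ⟨σ, hσi, hσj⟩ := MulAction.is_two_pretransitive_iff.1
    (Equiv.Perm.isMultiplyPretransitive (Fin (n + 2)) 2) hij hkl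
  obtain ⟨w, hw⟩ := h.exists_actsBy_of_perm σ
  exact ⟨w, σ, hw, hσi, hσj⟩

theorem IsStandard.exists_root_sub (h : IsStandard b e φ) {k l : Fin (n + 2)} (hkl : k ≠ l) :
    ∃ i, ∀ x, P.root' i x = φ x k - φ x l := by
  obtain ⟨w, σ, hw, hk, hl⟩ :=
    h.exists_actsBy_of_pair (Fin.castSucc_lt_succ (i := (0 : Fin (n + 1)))).ne hkl
  exact ⟨P.weylGroupToPerm w⁻¹ (e (Fin.castSucc 0)), fun x => by
    rw [← root'_coweightAction, h.root, simpleRoot_castSucc_dotProduct, hw, hw, hk, hl]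
    simp⟩

theorem IsStandard.exists_root_add (h : IsStandard b e φ) {k l : Fin (n + 2)} (hkl : k ≠ l) :
    ∃ i, ∀ x, P.root' i x = φ x k + φ x l := by
  obtain ⟨w, σ, hw, hk, hl⟩ := h.exists_actsBy_of_pair (Fin.castSucc_ne_last (Fin.last n)) hkl
  exact ⟨P.weylGroupToPerm w⁻¹ (e (Fin.last (n + 1))), fun x => by
    rw [← root'_coweightAction, h.root, simpleRoot_last_dotProduct, hw, hw, hk, hl]
    simp⟩

theorem IsStandard.exists_root'_eq [Finite ι] [P.IsCrystallographic] [P.IsReduced]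
    (h : IsStandard b e φ) (i : ι) :
    ∃ k l : Fin (n + 2), k ≠ l ∧ ∃ s t : ℤˣ, ∀ x, P.root' i x =
      ((s : ℤ) : ℝ) * φ x k + ((t : ℤ) : ℝ) * φ x l := by
  have hsimple : ∀ j ∈ b.support, ∃ σ ε, ActsBy φ (RootPairing.weylGroup.ofIdx P j) σ ε :=
    (forall_mem_support_iff e).2 fun k => by
      cases k using Fin.lastCases with
      | last => exact ⟨_, _, h.actsBy_last⟩
      | cast k => exact ⟨_, _, h.actsBy_castSucc k⟩
  refine b.induction_reflect i (p := fun i => ∃ k l : Fin (n + 2), k ≠ l ∧ ∃ s t : ℤˣ,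
    ∀ x, P.root' i x = ((s : ℤ) : ℝ) * φ x k + ((t : ℤ) : ℝ) * φ x l) ?_
    ((forall_mem_support_iff e).2 fun k => ?_) ?_
  · rintro i ⟨k, l, hkl, s, t, hst⟩
    refine ⟨k, l, hkl, -s, -t, fun x => ?_⟩
    rw [root'_reflectionPerm_self, hst]
    push_cast
    ring
  · cases k using Fin.lastCases with
    | last => exact ⟨_, _, Fin.castSucc_ne_last (Fin.last n), 1, 1, fun x => by simp [h.root]⟩
    | cast k =>
      exact ⟨_, _, (Fin.castSucc_lt_succ (i := k)).ne, 1, -1, fun x => by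
        simp [h.root, sub_eq_add_neg]⟩
  · rintro i j ⟨k, l, hkl, s, t, hst⟩ hj
    obtain ⟨σ, ε, hσ⟩ := hsimple j hj
    refine ⟨σ k, σ l, σ.injective.ne hkl, s * ε k, t * ε l, fun x => ?_⟩
    rw [root'_reflectionPerm, hst, hσ, hσ]
    push_cast
    ring

end Roots

section DoubledCoordinates

variable {n : ℕ} {ι M N : Type*} [AddCommGroup M] [Module ℝ M] [AddCommGroup N] [Module ℝ N]
  {P : RootPairing ι ℝ M N} {b : P.Base} {e : Fin (n + 2) ≃ b.support}
  {φ : N ≃ₗ[ℝ] (Fin (n + 2) → ℝ)}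

theorem IsStandard.exists_int_eq_two_mul (h : IsStandard b e φ) (x : coweightLattice P)
    (k : Fin (n + 2)) : ∃ m : ℤ, (m : ℝ) = 2 * φ (x : N) k := by
  obtain ⟨l, hl⟩ := exists_ne k
  obtain ⟨i, hi⟩ := h.exists_root_sub hl.symm
  obtain ⟨j, hj⟩ := h.exists_root_add hl.symm
  obtain ⟨c, hc⟩ := x.2 i
  obtain ⟨d, hd⟩ := x.2 j
  refine ⟨c + d, ?_⟩
  rw [Int.cast_add, ← hc, ← hd, hi, hj]
  ring

/-- Twice the standard coordinates of a point of the coweight lattice: the coordinates themselves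
are integers or half-integers. -/
noncomputable def doubled (h : IsStandard b e φ) : coweightLattice P →+ (Fin (n + 2) → ℤ) :=
  AddMonoidHom.mk' (fun x k => ⌊2 * φ (x : N) k⌋) fun x y => by
    ext k
    obtain ⟨m, hm⟩ := h.exists_int_eq_two_mul x k
    simp [mul_add, ← hm]

theorem doubled_spec (h : IsStandard b e φ) (x : coweightLattice P) (k : Fin (n + 2)) :
    (doubled h x k : ℝ) = 2 * φ (x : N) k := by
  obtain ⟨m, hm⟩ := h.exists_int_eq_two_mul x k
  rw [doubled, AddMonoidHom.mk'_apply, ← hm, Int.floor_intCast]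

theorem doubled_injective (h : IsStandard b e φ) : Function.Injective (doubled h) := by
  intro x y hxy
  ext
  apply φ.injective
  ext k
  have hk : 2 * φ (x : N) k = 2 * φ (y : N) k := by
    rw [← doubled_spec h, ← doubled_spec h, hxy]
  exact mul_left_cancel₀ two_ne_zero hk

theorem two_dvd_doubled_sub (h : IsStandard b e φ) (x : coweightLattice P)
    (k l : Fin (n + 2)) : (2 : ℤ) ∣ doubled h x k - doubled h x l := by
  rcases eq_or_ne k l with rfl | hkl
  · simp
  obtain ⟨i, hi⟩ := h.exists_root_sub hkl
  obtain ⟨c, hc⟩ := x.2 i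
  refine ⟨c, Int.cast_injective (α := ℝ) ?_⟩
  rw [Int.cast_sub, doubled_spec, doubled_spec, Int.cast_mul, ← hc, hi, ← mul_sub, Int.cast_ofNat]

theorem doubled_latticeAction (h : IsStandard b e φ) {w : P.weylGroup}
    {σ : Equiv.Perm (Fin (n + 2))} {ε : Fin (n + 2) → ℤˣ} (hw : ActsBy φ w σ ε)
    (x : coweightLattice P) (k : Fin (n + 2)) :
    doubled h (latticeAction P w x) k = ε k * doubled h x (σ k) := by
  rw [← Int.cast_inj (α := ℝ), Int.cast_mul, doubled_spec, doubled_spec, mul_left_comm]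
  exact congrArg (2 * ·) (hw x k)

variable [Finite ι] [P.IsCrystallographic] [P.IsReduced]

theorem exists_doubled_eq (h : IsStandard b e φ) (y : Fin (n + 2) → ℤ)
    (hy : ∀ k l, (2 : ℤ) ∣ y k - y l) : ∃ x, doubled h x = y := by
  have hφ : ∀ k, φ (φ.symm fun k => (y k : ℝ) / 2) k = (y k : ℝ) / 2 := by simp
  refine ⟨⟨φ.symm fun k => (y k : ℝ) / 2, fun i => ?_⟩, ?_⟩
  · obtain ⟨k, l, -, s, t, hst⟩ := h.exists_root'_eq i
    obtain ⟨c, hc⟩ := hy k l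
    have hyk : (y k : ℝ) = y l + 2 * c := by exact_mod_cast eq_add_of_sub_eq' hc
    rw [hst, hφ, hφ, hyk]
    rcases Int.units_eq_one_or s with rfl | rfl <;> rcases Int.units_eq_one_or t with rfl | rfl
    · exact ⟨y l + c, by push_cast; ring⟩
    · exact ⟨c, by push_cast; ring⟩
    · exact ⟨-c, by push_cast; ring⟩
    · exact ⟨-y l - c, by push_cast; ring⟩
  · ext k
    rw [← Int.cast_inj (α := ℝ), doubled_spec, hφ]
    ring

theorem mem_multiples_iff_exists_doubled (h : IsStandard b e φ) {q : ℕ} (x : coweightLattice P) :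
    x ∈ multiples P q ↔
      ∃ y : Fin (n + 2) → ℤ, (∀ k l, (2 : ℤ) ∣ y k - y l) ∧ ∀ k, doubled h x k = q * y k := by
  constructor
  · rintro ⟨z, rfl⟩
    exact ⟨doubled h z, two_dvd_doubled_sub h z, fun k => by simp⟩
  · rintro ⟨y, hy, hxy⟩
    obtain ⟨z, rfl⟩ := exists_doubled_eq h y hy
    exact ⟨z, doubled_injective h (funext fun k => by simp [hxy])⟩

theorem intCast_eq_zero_iff_exists {q : ℕ} {m : ℤ} :
    (m : ZMod (2 * q)) = 0 ↔ ∃ c : ℤ, m = q * (2 * c) := by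
  rw [ZMod.intCast_zmod_eq_zero_iff_dvd, Nat.cast_mul, Nat.cast_ofNat, mul_comm]
  exact exists_congr fun c => by rw [mul_assoc]

theorem intCast_eq_natCast_iff_exists {q : ℕ} {m : ℤ} :
    (m : ZMod (2 * q)) = q ↔ ∃ c : ℤ, m = q * (2 * c + 1) := by
  rw [← sub_eq_zero, ← Int.cast_natCast q, ← Int.cast_sub, intCast_eq_zero_iff_exists]
  exact exists_congr fun c => by rw [sub_eq_iff_eq_add, mul_add_one]

theorem mem_multiples_iff (h : IsStandard b e φ) {q : ℕ} (x : coweightLattice P) :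
    x ∈ multiples P q ↔ (∀ k, ((doubled h x k : ℤ) : ZMod (2 * q)) = 0) ∨
      ∀ k, ((doubled h x k : ℤ) : ZMod (2 * q)) = q := by
  simp only [intCast_eq_zero_iff_exists, intCast_eq_natCast_iff_exists]
  rw [mem_multiples_iff_exists_doubled h]
  constructor
  · rintro ⟨y, hy, hxy⟩
    choose c hc using fun k => hy k 0
    have hy0 : ∀ k, y k = 2 * c k + y 0 := fun k => eq_add_of_sub_eq (hc k)
    rcases Int.even_or_odd' (y 0) with ⟨d, hd | hd⟩
    · exact Or.inl fun k => ⟨c k + d, by rw [hxy, hy0, hd]; ring⟩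
    · exact Or.inr fun k => ⟨c k + d, by rw [hxy, hy0, hd]; ring⟩
  · rintro (hx | hx) <;> choose c hc using hx
    · exact ⟨fun k => 2 * c k, fun k l => ⟨c k - c l, by ring⟩, hc⟩
    · exact ⟨fun k => 2 * c k + 1, fun k l => ⟨c k - c l, by ring⟩, hc⟩

end DoubledCoordinates

theorem two_mul_natCard_eq_of_twoToOne {X A B : Type*} {f : X → A} {g : X → B} {τ : A → A}
    (hf : Function.Surjective f) (hg : Function.Surjective g) (hτ : Function.Involutive τ)
    (hfix : ∀ a, τ a ≠ a) (hfg : ∀ x x', g x = g x' ↔ f x' = f x ∨ f x' = τ (f x)) :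
    2 * Nat.card B = Nat.card A := by
  obtain ⟨s, hs⟩ := hg.hasRightInverse
  have hgs : ∀ {y y'}, f (s y') = f (s y) ∨ f (s y') = τ (f (s y)) → y = y' := fun {y y'} hy => by
    rw [← hs y, ← hs y', hfg]
    exact hy
  have hbij : Function.Bijective fun p : Bool × B => if p.1 then τ (f (s p.2)) else f (s p.2) := by
    constructor
    · rintro ⟨_ | _, y⟩ ⟨_ | _, y'⟩ hyy <;> simp only [if_true, if_false, Bool.false_eq_true] at hyy
      · rw [hgs (Or.inl hyy.symm)]
      · obtain rfl := hgs (Or.inr hyy)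
        exact absurd hyy.symm (hfix _)
      · obtain rfl := hgs (Or.inr hyy.symm)
        exact absurd hyy (hfix _)
      · rw [hgs (Or.inl (hτ.injective hyy).symm)]
    · intro a
      obtain ⟨x, rfl⟩ := hf a
      rcases (hfg (s (g x)) x).1 (hs (g x)) with hx | hx
      · exact ⟨(false, g x), hx.symm⟩
      · exact ⟨(true, g x), hx.symm⟩
  rw [← Nat.card_eq_of_bijective _ hbij, Nat.card_prod, Nat.card_eq_fintype_card (α := Bool),
    Fintype.card_bool]

section UpToSign

/-- The class `{a, -a}` of an element of an additive group. -/
def upToSign {G : Type*} [Neg G] (a : G) : Sym2 G := s(a, -a)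

theorem upToSign_eq_iff {G : Type*} [AddGroup G] {a b : G} :
    upToSign a = upToSign b ↔ a = b ∨ a = -b := by
  rw [upToSign, upToSign, Sym2.eq_iff, neg_inj, and_self, neg_eq_iff_eq_neg, and_self]

end UpToSign

section Configurations

variable {n : ℕ}

/-- The class modulo `2` of an element of `ZMod (2 * q)`. -/
def parity (q : ℕ) : ZMod (2 * q) →+* ZMod 2 := ZMod.castHom (dvd_mul_right 2 q) (ZMod 2)

/-- The doubled coordinates modulo `2q` of the points of the complement of the arrangement: as the
roots are `± x_k ± x_l`, the conditions say that no two coordinates agree up to sign. -/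
def IsConfiguration (q : ℕ) (y : Fin n → ZMod (2 * q)) : Prop :=
  (∀ k l, parity q (y k) = parity q (y l)) ∧ Function.Injective (upToSign ∘ y)

/-- The doubled coordinates modulo `2q` of the points fixed by a signed permutation: adding `q` to
all of them does not change the point modulo `qZ`. -/
def IsFixedBy (q : ℕ) (σ : Equiv.Perm (Fin n)) (ε : Fin n → ℤˣ) (y : Fin n → ZMod (2 * q)) :
    Prop :=
  (∀ k, ((ε k : ℤ) : ZMod (2 * q)) * y (σ k) = y k) ∨
    ∀ k, ((ε k : ℤ) : ZMod (2 * q)) * y (σ k) = y k + q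

theorem natCast_add_self (q : ℕ) : (q : ZMod (2 * q)) + q = 0 := by
  rw [← two_mul]
  exact_mod_cast ZMod.natCast_self (2 * q)

theorem neg_natCast_eq (q : ℕ) : -(q : ZMod (2 * q)) = q :=
  neg_eq_of_add_eq_zero_left (natCast_add_self q)

theorem natCast_ne_zero (q : ℕ) [NeZero q] : (q : ZMod (2 * q)) ≠ 0 := by
  rw [Ne, ZMod.natCast_eq_zero_iff]
  exact Nat.not_dvd_of_pos_of_lt (NeZero.pos q) (by have := NeZero.pos q; omega)

theorem upToSign_add_natCast_eq_iff {q : ℕ} {a b : ZMod (2 * q)} :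
    upToSign (a + q) = upToSign (b + q) ↔ upToSign a = upToSign b := by
  rw [upToSign_eq_iff, upToSign_eq_iff, neg_add, neg_natCast_eq, add_left_inj, add_left_inj]

theorem IsConfiguration.add {q : ℕ} {y : Fin n → ZMod (2 * q)} (hy : IsConfiguration q y) :
    IsConfiguration q (fun k => y k + q) :=
  ⟨fun k l => by rw [map_add, map_add, hy.1 k l],
    fun _ _ hkl => hy.2 (upToSign_add_natCast_eq_iff.1 hkl)⟩

theorem IsFixedBy.add {q : ℕ} {σ : Equiv.Perm (Fin n)} {ε : Fin n → ℤˣ}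
    {y : Fin n → ZMod (2 * q)} (hy : IsFixedBy q σ ε y) :
    IsFixedBy q σ ε (fun k => y k + q) := by
  have hε : ∀ k, ((ε k : ℤ) : ZMod (2 * q)) * q = q := fun k => by
    rcases Int.units_eq_one_or (ε k) with hk | hk <;> simp [hk, neg_natCast_eq]
  exact hy.imp (fun hy k => by rw [mul_add, hε, hy]) fun hy k => by rw [mul_add, hε, hy]

end Configurations

section Reduction

variable {n : ℕ} {ι M N : Type*} [AddCommGroup M] [Module ℝ M] [AddCommGroup N] [Module ℝ N]
  {P : RootPairing ι ℝ M N} {b : P.Base} {e : Fin (n + 2) ≃ b.support}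
  {φ : N ≃ₗ[ℝ] (Fin (n + 2) → ℝ)}

/-- The doubled coordinates of a point of the coweight lattice modulo `2q`. -/
noncomputable def reduced (h : IsStandard b e φ) (q : ℕ) (x : coweightLattice P) (k : Fin (n + 2)) :
    ZMod (2 * q) :=
  (doubled h x k : ℤ)

theorem intCast_eq_zero_iff_of_eq_two_mul {q : ℕ} {m : ℤ} {r : ℝ} (hm : (m : ℝ) = 2 * r) :
    (m : ZMod (2 * q)) = 0 ↔ ∃ c : ℤ, r = q * c := by
  rw [intCast_eq_zero_iff_exists]
  refine exists_congr fun c => ?_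
  rw [← Int.cast_inj (α := ℝ), hm, mul_left_comm, Int.cast_mul, Int.cast_ofNat,
    mul_right_inj' two_ne_zero, Int.cast_mul, Int.cast_natCast]

theorem reduced_eq_reduced_iff (h : IsStandard b e φ) {q : ℕ} (x : coweightLattice P)
    (k l : Fin (n + 2)) :
    reduced h q x k = reduced h q x l ↔ ∃ c : ℤ, φ (x : N) k - φ (x : N) l = q * c := by
  rw [reduced, reduced, ← sub_eq_zero, ← Int.cast_sub]
  exact intCast_eq_zero_iff_of_eq_two_mul (by push_cast; rw [doubled_spec, doubled_spec, mul_sub])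

theorem reduced_eq_neg_reduced_iff (h : IsStandard b e φ) {q : ℕ} (x : coweightLattice P)
    (k l : Fin (n + 2)) :
    reduced h q x k = -reduced h q x l ↔ ∃ c : ℤ, φ (x : N) k + φ (x : N) l = q * c := by
  rw [reduced, reduced, ← sub_eq_zero, sub_neg_eq_add, ← Int.cast_add]
  exact intCast_eq_zero_iff_of_eq_two_mul (by push_cast; rw [doubled_spec, doubled_spec, mul_add])

theorem parity_reduced_eq (h : IsStandard b e φ) (q : ℕ) (x : coweightLattice P)
    (k l : Fin (n + 2)) : parity q (reduced h q x k) = parity q (reduced h q x l) := by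
  rw [reduced, reduced, map_intCast, map_intCast, ← sub_eq_zero, ← Int.cast_sub,
    ZMod.intCast_zmod_eq_zero_iff_dvd]
  exact two_dvd_doubled_sub h x k l

theorem isConfiguration_reduced_of_root' (h : IsStandard b e φ) {q : ℕ} {x : coweightLattice P}
    (hx : ∀ i, ¬ ∃ c : ℤ, P.root' i (x : N) = (q : ℝ) * c) :
    IsConfiguration q (reduced h q x) := by
  refine ⟨parity_reduced_eq h q x, fun k l hkl => by_contra fun hne => ?_⟩
  rcases upToSign_eq_iff.1 hkl with heq | heq
  · obtain ⟨i, hi⟩ := h.exists_root_sub hne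
    exact hx i (by rwa [hi, ← reduced_eq_reduced_iff h])
  · obtain ⟨i, hi⟩ := h.exists_root_add hne
    exact hx i (by rwa [hi, ← reduced_eq_neg_reduced_iff h])

variable [Finite ι] [P.IsCrystallographic] [P.IsReduced]

theorem isConfiguration_reduced_iff (h : IsStandard b e φ) {q : ℕ} {x : coweightLattice P} :
    IsConfiguration q (reduced h q x) ↔ ∀ i, ¬ ∃ c : ℤ, P.root' i (x : N) = (q : ℝ) * c := by
  refine ⟨?_, isConfiguration_reduced_of_root' h⟩
  rintro hx i ⟨c, hc⟩
  obtain ⟨k, l, hkl, s, t, hst⟩ := h.exists_root'_eq i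
  rw [hst] at hc
  refine hkl (hx.2 (upToSign_eq_iff.2 ?_))
  rw [reduced_eq_reduced_iff, reduced_eq_neg_reduced_iff]
  rcases Int.units_eq_one_or s with rfl | rfl <;> rcases Int.units_eq_one_or t with rfl | rfl <;>
    push_cast at hc
  · exact Or.inr ⟨c, by linear_combination hc⟩
  · exact Or.inl ⟨c, by linear_combination hc⟩
  · exact Or.inl ⟨-c, by push_cast; linear_combination -hc⟩
  · exact Or.inr ⟨-c, by push_cast; linear_combination -hc⟩

theorem mk_eq_mk_iff (h : IsStandard b e φ) {q : ℕ} (x x' : coweightLattice P) :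
    (x : ModLattice P q) = x' ↔ (∀ k, reduced h q x' k = reduced h q x k) ∨
      ∀ k, reduced h q x' k = reduced h q x k + q := by
  rw [QuotientAddGroup.eq, mem_multiples_iff h]
  simp only [neg_add_eq_sub, map_sub, Pi.sub_apply, Int.cast_sub, reduced, sub_eq_iff_eq_add',
    add_zero]

theorem mk_mem_modComplement_iff (h : IsStandard b e φ) {q : ℕ} (x : coweightLattice P) :
    (x : ModLattice P q) ∈ modComplement P q ↔ IsConfiguration q (reduced h q x) := by
  refine ⟨?_, fun hx => ⟨x, rfl, (isConfiguration_reduced_iff h).1 hx⟩⟩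
  rintro ⟨x', hx', hroot⟩
  have hconf := (isConfiguration_reduced_iff h).2 hroot
  rcases (mk_eq_mk_iff h x' x).1 hx' with heq | heq
  · rwa [funext heq]
  · rw [funext heq]
    exact hconf.add

theorem modAction_mk_eq_iff (h : IsStandard b e φ) {q : ℕ} {w : P.weylGroup}
    {σ : Equiv.Perm (Fin (n + 2))} {ε : Fin (n + 2) → ℤˣ} (hw : ActsBy φ w σ ε)
    (x : coweightLattice P) :
    modAction P q w (x : ModLattice P q) = x ↔ IsFixedBy q σ ε (reduced h q x) := by
  rw [eq_comm]
  change (x : ModLattice P q) = (latticeAction P w x : coweightLattice P) ↔ _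
  rw [mk_eq_mk_iff h]
  simp only [reduced, doubled_latticeAction h hw, Int.cast_mul, IsFixedBy]

theorem exists_reduced_eq (h : IsStandard b e φ) {q : ℕ}
    (y : Fin (n + 2) → ZMod (2 * q)) (hy : ∀ k l, parity q (y k) = parity q (y l)) :
    ∃ x, reduced h q x = y := by
  choose z hz using fun k => ZMod.intCast_surjective (y k)
  obtain ⟨x, hx⟩ := exists_doubled_eq h z fun k l => by
    have hkl := hy k l
    rw [← hz, ← hz, map_intCast, map_intCast, ← sub_eq_zero, ← Int.cast_sub] at hkl
    exact (ZMod.intCast_zmod_eq_zero_iff_dvd _ 2).1 hkl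
  exact ⟨x, funext fun k => by rw [reduced, hx, hz]⟩

theorem two_mul_equivChar (h : IsStandard b e φ) {q : ℕ} [NeZero q] {w : P.weylGroup}
    {σ : Equiv.Perm (Fin (n + 2))} {ε : Fin (n + 2) → ℤˣ} (hw : ActsBy φ w σ ε) :
    2 * equivChar P q w =
      Nat.card {y : Fin (n + 2) → ZMod (2 * q) // IsConfiguration q y ∧ IsFixedBy q σ ε y} := by
  have hiff : ∀ x : coweightLattice P,
      ((x : ModLattice P q) ∈ modComplement P q ∧ modAction P q w (x : ModLattice P q) = x) ↔
        IsConfiguration q (reduced h q x) ∧ IsFixedBy q σ ε (reduced h q x) := fun x => by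
    rw [mk_mem_modComplement_iff h, modAction_mk_eq_iff h hw]
  refine two_mul_natCard_eq_of_twoToOne
    (X := {x // IsConfiguration q (reduced h q x) ∧ IsFixedBy q σ ε (reduced h q x)})
    (f := fun x => ⟨reduced h q x, x.2⟩) (g := fun x => ⟨x.1, (hiff x).2 x.2⟩)
    (τ := fun y => ⟨fun k => y.1 k + q, y.2.1.add, y.2.2.add⟩) ?_ ?_ ?_ ?_ ?_
  · rintro ⟨y, hy⟩
    obtain ⟨x, rfl⟩ := exists_reduced_eq h y hy.1.1
    exact ⟨⟨x, hy⟩, rfl⟩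
  · rintro ⟨m, hm⟩
    obtain ⟨x, rfl⟩ := QuotientAddGroup.mk_surjective m
    exact ⟨⟨x, (hiff x).1 hm⟩, rfl⟩
  · exact fun y => Subtype.ext (funext fun k => by simp [add_assoc, natCast_add_self])
  · exact fun y hy => natCast_ne_zero q (by simpa using congrFun (congrArg Subtype.val hy) 0)
  · intro x x'
    simp only [Subtype.mk.injEq, funext_iff]
    exact mk_eq_mk_iff h x.1 x'.1

end Reduction

section Parity

variable {q : ℕ}

theorem add_self_eq_zero_iff {a : ZMod (2 * q)} : a + a = 0 ↔ a = 0 ∨ a = q := by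
  refine ⟨fun ha => ?_, ?_⟩
  · obtain ⟨m, rfl⟩ := ZMod.intCast_surjective a
    rw [← Int.cast_add, intCast_eq_zero_iff_exists] at ha
    rw [intCast_eq_zero_iff_exists, intCast_eq_natCast_iff_exists]
    obtain ⟨c, hc⟩ := ha
    have hm : m = q * c := by linarith
    rcases Int.even_or_odd' c with ⟨d, rfl | rfl⟩
    exacts [Or.inl ⟨d, hm⟩, Or.inr ⟨d, hm⟩]
  · rintro (rfl | rfl)
    exacts [add_zero 0, natCast_add_self q]

theorem parity_natCast_self_of_odd (hq : Odd q) : parity q (q : ZMod (2 * q)) = 1 := by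
  rw [map_natCast, ZMod.natCast_eq_one_iff_odd]
  exact hq

theorem parity_natCast_self_of_even (hq : Even q) : parity q (q : ZMod (2 * q)) = 0 := by
  rw [map_natCast, ZMod.natCast_eq_zero_iff_even]
  exact hq

theorem parity_neg (a : ZMod (2 * q)) : parity q (-a) = parity q a := by
  rw [map_neg, ZMod.neg_eq_self_mod_two]

theorem parity_eq_zero_of_add_self (hq : Even q) {a : ZMod (2 * q)} (ha : a + a = 0) :
    parity q a = 0 := by
  rcases add_self_eq_zero_iff.1 ha with rfl | rfl
  exacts [map_zero _, parity_natCast_self_of_even hq]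

theorem upToSign_ne_of_add_self {a s : ZMod (2 * q)} (hs : s + s = 0) (ha : a + a ≠ 0) :
    upToSign a ≠ upToSign s := by
  rw [Ne, upToSign_eq_iff, neg_eq_of_add_eq_zero_left hs, or_self]
  rintro rfl
  exact ha hs

variable (q) [NeZero q]

/-- The elements of `ZMod (2 * q)` of parity `p`. -/
def parityClass (p : ZMod 2) : Finset (ZMod (2 * q)) := {a | parity q a = p}

/-- The elements of `ZMod (2 * q)` of parity `p` which differ from their negatives. -/
def genericClass (p : ZMod 2) : Finset (ZMod (2 * q)) := {a | parity q a = p ∧ a + a ≠ 0}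

variable {q} {p : ZMod 2} {a : ZMod (2 * q)}

theorem mem_parityClass : a ∈ parityClass q p ↔ parity q a = p := by
  simp [parityClass]

theorem mem_genericClass : a ∈ genericClass q p ↔ parity q a = p ∧ a + a ≠ 0 := by
  simp [genericClass]

theorem card_parityClass (p : ZMod 2) : (parityClass q p).card = q := by
  have hsurj : Function.Surjective (parity q) := ZMod.ringHom_surjective _
  have hfiber : ∀ p', (parityClass q p').card = (parityClass q p).card := fun p' =>
    AddMonoidHom.card_fiber_eq_of_mem_range (parity q).toAddMonoidHom (hsurj p') (hsurj p)
  have hsum := Finset.card_eq_sum_card_fiberwise (f := parity q) (s := Finset.univ)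
    (t := Finset.univ) (fun _ _ => Finset.mem_coe.2 (Finset.mem_univ _))
  change _ = ∑ p', (parityClass q p').card at hsum
  rw [Finset.card_univ, ZMod.card, Finset.sum_congr rfl fun p' _ => hfiber p', Finset.sum_const,
    Finset.card_univ, ZMod.card, smul_eq_mul] at hsum
  omega

theorem parityClass_eq_insert_of_odd (hq : Odd q) (p : ZMod 2) :
    ∃ s : ZMod (2 * q), s + s = 0 ∧ parityClass q p = insert s (genericClass q p) := by
  have hp : p = 0 ∨ p = 1 := by decide +revert
  have hodd := parity_natCast_self_of_odd hq
  rcases hp with rfl | rfl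
  · refine ⟨0, add_zero 0, Finset.ext fun a => ?_⟩
    rw [Finset.mem_insert, mem_parityClass, mem_genericClass, Ne, add_self_eq_zero_iff]
    by_cases ha : a = q
    · simp [ha, hodd, natCast_ne_zero]
    · by_cases ha0 : a = 0 <;> simp [ha, ha0]
  · refine ⟨q, natCast_add_self q, Finset.ext fun a => ?_⟩
    rw [Finset.mem_insert, mem_parityClass, mem_genericClass, Ne, add_self_eq_zero_iff]
    by_cases ha : a = 0
    · simp [ha, (natCast_ne_zero q).symm]
    · by_cases haq : a = q <;> simp [ha, haq, hodd]

theorem parityClass_zero_of_even (hq : Even q) :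
    parityClass q 0 = insert 0 (insert (q : ZMod (2 * q)) (genericClass q 0)) := by
  ext a
  rw [Finset.mem_insert, Finset.mem_insert, mem_parityClass, mem_genericClass, ← or_assoc,
    ← add_self_eq_zero_iff]
  have := parity_eq_zero_of_add_self hq (a := a)
  tauto

theorem parityClass_one_of_even (hq : Even q) : parityClass q 1 = genericClass q 1 := by
  ext a
  rw [mem_parityClass, mem_genericClass, iff_self_and]
  intro ha hself
  exact zero_ne_one ((parity_eq_zero_of_add_self hq hself).symm.trans ha)

theorem card_genericClass_of_odd (hq : Odd q) (p : ZMod 2) :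
    ((genericClass q p).card : ℚ) = q - 1 := by
  obtain ⟨s, hs, hinsert⟩ := parityClass_eq_insert_of_odd hq p
  have hcard := congrArg Finset.card hinsert
  rw [card_parityClass, Finset.card_insert_of_notMem fun hmem => (mem_genericClass.1 hmem).2 hs]
    at hcard
  rw [eq_sub_iff_add_eq]
  exact_mod_cast hcard.symm

theorem card_genericClass_zero_of_even (hq : Even q) :
    ((genericClass q 0).card : ℚ) = q - 2 := by
  have hcard := congrArg Finset.card (parityClass_zero_of_even hq)
  rw [card_parityClass, Finset.card_insert_of_notMem, Finset.card_insert_of_notMem] at hcard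
  · rw [eq_sub_iff_add_eq]
    exact_mod_cast hcard.symm
  · simp [mem_genericClass, natCast_add_self]
  · simp [mem_genericClass, (natCast_ne_zero q).symm]

end Parity

section ConfigurationCount

variable {q : ℕ} [NeZero q]

theorem card_separatedTuples_genericClass (n : ℕ) (p : ZMod 2) :
    ((separatedTuples upToSign n (genericClass q p)).card : ℚ) =
      ∏ i ∈ Finset.range n, ((genericClass q p).card - 2 * (i : ℚ)) := by
  refine card_separatedTuples_of_card_fiber (d := 2) n _ fun a ha => ?_
  obtain ⟨hp, ha⟩ := mem_genericClass.1 ha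
  refine Eq.trans (congrArg Finset.card ?_)
    (Finset.card_pair fun hneg : a = -a => ha (add_eq_zero_iff_eq_neg.2 hneg))
  ext x
  rw [Finset.mem_filter, upToSign_eq_iff, Finset.mem_insert, Finset.mem_singleton,
    and_iff_right_iff_imp, mem_genericClass]
  rintro (rfl | rfl)
  · exact ⟨hp, ha⟩
  · rw [parity_neg, ← neg_add, Ne, neg_eq_zero]
    exact ⟨hp, ha⟩

theorem card_separatedTuples_parityClass_of_odd (hq : Odd q) (n : ℕ) (p : ZMod 2) :
    ((separatedTuples upToSign (n + 1) (parityClass q p)).card : ℚ) =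
      (∏ i ∈ Finset.range n, ((q : ℚ) - (2 * i + 1))) * (q - n) := by
  obtain ⟨s, hs, hinsert⟩ := parityClass_eq_insert_of_odd hq p
  have hne : ∀ a ∈ genericClass q p, upToSign a ≠ upToSign s := fun a ha =>
    upToSign_ne_of_add_self hs (mem_genericClass.1 ha).2
  rw [hinsert, card_separatedTuples_insert _ _ hne]
  push_cast
  rw [card_separatedTuples_genericClass, card_separatedTuples_genericClass,
    card_genericClass_of_odd hq, Finset.prod_range_succ,
    Finset.prod_congr rfl fun (i : ℕ) _ => (by ring : (q : ℚ) - 1 - 2 * i = q - (2 * i + 1))]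
  ring

theorem card_separatedTuples_parityClass_one_of_even (hq : Even q) (n : ℕ) :
    ((separatedTuples upToSign n (parityClass q 1)).card : ℚ) =
      ∏ i ∈ Finset.range n, ((q : ℚ) - 2 * i) := by
  rw [parityClass_one_of_even hq, card_separatedTuples_genericClass, ← parityClass_one_of_even hq,
    card_parityClass]

theorem card_separatedTuples_genericClass_zero_of_even (hq : Even q) (n : ℕ) :
    ((separatedTuples upToSign n (genericClass q 0)).card : ℚ) =
      ∏ i ∈ Finset.range n, ((q : ℚ) - 2 * (i + 1)) := by
  rw [card_separatedTuples_genericClass, card_genericClass_zero_of_even hq]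
  exact Finset.prod_congr rfl fun i _ => by ring

theorem card_separatedTuples_parityClass_zero_of_even (hq : Even q) (n : ℕ) :
    ((separatedTuples upToSign (n + 2) (parityClass q 0)).card : ℚ) =
      (∏ i ∈ Finset.range n, ((q : ℚ) - 2 * (i + 1))) *
        ((q - 2 * (n + 1)) * (q - 2 * (n + 2)) + 2 * (n + 2) * (q - 2 * (n + 1)) +
          (n + 2) * (n + 1)) := by
  have hqne : ∀ a ∈ genericClass q 0, upToSign a ≠ upToSign (q : ZMod (2 * q)) := fun a ha =>
    upToSign_ne_of_add_self (natCast_add_self q) (mem_genericClass.1 ha).2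
  have hzero : ∀ a ∈ insert (q : ZMod (2 * q)) (genericClass q 0), upToSign a ≠ upToSign 0 := by
    refine Finset.forall_mem_insert _ _ _ |>.2 ⟨?_, fun a ha =>
      upToSign_ne_of_add_self (add_zero 0) (mem_genericClass.1 ha).2⟩
    simp [upToSign_eq_iff, natCast_ne_zero]
  rw [parityClass_zero_of_even hq, card_separatedTuples_insert _ _ hzero,
    card_separatedTuples_insert _ _ hqne, card_separatedTuples_insert _ _ hqne]
  push_cast
  simp only [card_separatedTuples_genericClass_zero_of_even hq, Finset.prod_range_succ]
  push_cast
  ring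

theorem natCard_isConfiguration (n : ℕ) :
    Nat.card {y : Fin (n + 1) → ZMod (2 * q) // IsConfiguration q y} =
      (separatedTuples upToSign (n + 1) (parityClass q 0)).card +
        (separatedTuples upToSign (n + 1) (parityClass q 1)).card := by
  classical
  rw [Nat.card_eq_fintype_card, Fintype.card_subtype, Finset.card_eq_sum_card_fiberwise
    (f := fun y => parity q (y 0)) (t := Finset.univ) fun _ _ => Finset.mem_coe.2
      (Finset.mem_univ _)]
  refine (Finset.sum_congr rfl fun p _ => congrArg Finset.card ?_).trans (Fin.sum_univ_two
    fun p : ZMod 2 => (separatedTuples upToSign (n + 1) (parityClass q p)).card)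
  ext y
  rw [Finset.mem_filter, Finset.mem_filter_univ, mem_separatedTuples]
  simp only [mem_parityClass]
  constructor
  · rintro ⟨⟨hpar, hinj⟩, rfl⟩
    exact ⟨fun i => hpar i 0, hinj⟩
  · rintro ⟨hpar, hinj⟩
    exact ⟨⟨fun k l => by rw [hpar, hpar], hinj⟩, hpar 0⟩

theorem natCard_isConfiguration_of_odd (hq : Odd q) (n : ℕ) :
    (Nat.card {y : Fin (n + 1) → ZMod (2 * q) // IsConfiguration q y} : ℚ) =
      2 * ((∏ i ∈ Finset.range n, ((q : ℚ) - (2 * i + 1))) * (q - n)) := by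
  rw [natCard_isConfiguration, Nat.cast_add, card_separatedTuples_parityClass_of_odd hq,
    card_separatedTuples_parityClass_of_odd hq, two_mul]

theorem natCard_isConfiguration_of_even (hq : Even q) (n : ℕ) :
    (Nat.card {y : Fin (n + 2) → ZMod (2 * q) // IsConfiguration q y} : ℚ) =
      2 * ((∏ i ∈ Finset.range n, ((q : ℚ) - 2 * (i + 1))) *
        (q ^ 2 - 2 * (n + 1) * q + (n + 2) * (n + 1) / 2)) := by
  rw [natCard_isConfiguration, Nat.cast_add, card_separatedTuples_parityClass_zero_of_even hq,
    card_separatedTuples_parityClass_one_of_even hq, Finset.prod_range_succ',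
    Finset.prod_range_succ]
  push_cast
  ring

end ConfigurationCount

section FixedByOmegaOne

variable {n q : ℕ}

/-- The pairs of ends of the configurations fixed by `ω₁` when `q` is even. -/
def selfNegativePairs (q : ℕ) : Finset (ZMod (2 * q) × ZMod (2 * q)) := {(0, ↑q), (↑q, 0)}

theorem mem_selfNegativePairs {a b : ZMod (2 * q)} (hab : upToSign a ≠ upToSign b) :
    (a, b) ∈ selfNegativePairs q ↔ a + a = 0 ∧ b + b = 0 := by
  have hne : a ≠ b := fun h => hab (congrArg upToSign h)
  rw [selfNegativePairs, Finset.mem_insert, Finset.mem_singleton, Prod.mk_inj, Prod.mk_inj,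
    add_self_eq_zero_iff, add_self_eq_zero_iff]
  grind

variable [NeZero q]

theorem card_selfNegativePairs : (selfNegativePairs q).card = 2 :=
  Finset.card_pair fun h => natCast_ne_zero q (Prod.ext_iff.1 h).1.symm

theorem isFixedBy_omega_zero_iff (hn : n ≠ 0) {y : Fin (n + 2) → ZMod (2 * q)} :
    IsFixedBy q 1 (fun k => if k = 0 ∨ k = Fin.last (n + 1) then -1 else 1) y ↔
      y 0 + y 0 = 0 ∧ y (Fin.last (n + 1)) + y (Fin.last (n + 1)) = 0 := by
  have hneg : ∀ a : ZMod (2 * q), -a = a ↔ a + a = 0 := fun a => by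
    rw [add_eq_zero_iff_eq_neg, eq_comm]
  have hshift : ¬ ∀ k, (((if k = 0 ∨ k = Fin.last (n + 1) then -1 else 1 : ℤˣ) : ℤ) :
      ZMod (2 * q)) * y k = y k + q := fun hy => by
    have h1 : (1 : Fin (n + 2)) ≠ Fin.last (n + 1) := by simpa [Fin.ext_iff] using hn
    simpa [h1, natCast_ne_zero] using hy 1
  simp only [IsFixedBy, Equiv.Perm.one_apply, hshift, or_false]
  constructor
  · intro hy
    exact ⟨by simpa [hneg] using hy 0, by simpa [hneg] using hy (Fin.last (n + 1))⟩
  · rintro ⟨h0, hlast⟩ k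
    split_ifs with hk
    · rcases hk with rfl | rfl <;> simpa [hneg]
    · simp

theorem natCard_fixedBy_omega_zero_of_odd (hq : Odd q) (hn : n ≠ 0) :
    Nat.card {y : Fin (n + 2) → ZMod (2 * q) // IsConfiguration q y ∧
      IsFixedBy q 1 (fun k => if k = 0 ∨ k = Fin.last (n + 1) then -1 else 1) y} = 0 := by
  refine Nat.card_eq_zero.2 (Or.inl ⟨fun ⟨y, ⟨hpar, hinj⟩, hfix⟩ => ?_⟩)
  have hends : upToSign (y 0) ≠ upToSign (y (Fin.last (n + 1))) := hinj.ne (Fin.last_pos).ne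
  have hodd := parity_natCast_self_of_odd hq
  have hpair := (mem_selfNegativePairs hends).2 ((isFixedBy_omega_zero_iff hn).1 hfix)
  have hpar := hpar 0 (Fin.last (n + 1))
  rw [selfNegativePairs, Finset.mem_insert, Finset.mem_singleton, Prod.mk_inj, Prod.mk_inj] at hpair
  rcases hpair with ⟨h0, hlast⟩ | ⟨h0, hlast⟩ <;>
    simp [h0, hlast, hodd, -map_natCast] at hpar

theorem isConfiguration_and_isFixedBy_omega_zero_iff (hq : Even q) (hn : n ≠ 0)
    {y : Fin (n + 2) → ZMod (2 * q)} :
    IsConfiguration q y ∧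
        IsFixedBy q 1 (fun k => if k = 0 ∨ k = Fin.last (n + 1) then -1 else 1) y ↔
      (y 0, y (Fin.last (n + 1))) ∈ selfNegativePairs q ∧
        (∀ i : Fin n, y i.castSucc.succ ∈ genericClass q 0) ∧
          Function.Injective (upToSign ∘ y) := by
  rw [isFixedBy_omega_zero_iff hn, IsConfiguration]
  constructor
  · rintro ⟨⟨hpar, hinj⟩, hends⟩
    have hne := hinj.ne (Fin.last_pos (n := n)).ne
    refine ⟨(mem_selfNegativePairs hne).2 hends, fun i => mem_genericClass.2 ⟨?_, fun hi => ?_⟩,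
      hinj⟩
    · rw [hpar _ 0, parity_eq_zero_of_add_self hq hends.1]
    · have hne0 : y i.castSucc.succ ≠ y 0 := (hinj.of_comp).ne (Fin.succ_ne_zero _)
      have hnelast : y i.castSucc.succ ≠ y (Fin.last (n + 1)) :=
        (hinj.of_comp).ne (Fin.castSucc_lt_last i.succ).ne
      have hne' : y 0 ≠ y (Fin.last (n + 1)) := (hinj.of_comp).ne (Fin.last_pos (n := n)).ne
      simp only [add_self_eq_zero_iff] at hends hi
      grind
  · rintro ⟨hmem, hgen, hinj⟩
    have hends := (mem_selfNegativePairs (hinj.ne (Fin.last_pos (n := n)).ne)).1 hmem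
    have hpar : ∀ k, parity q (y k) = 0 := by
      refine Fin.cases (parity_eq_zero_of_add_self hq hends.1) fun i => ?_
      refine Fin.lastCases (parity_eq_zero_of_add_self hq hends.2) (fun i => ?_) i
      exact (mem_genericClass.1 (hgen i)).1
    exact ⟨⟨fun k l => by rw [hpar, hpar], hinj⟩, hends⟩

theorem natCard_fixedBy_omega_zero_of_even (hq : Even q) (hn : n ≠ 0) :
    (Nat.card {y : Fin (n + 2) → ZMod (2 * q) // IsConfiguration q y ∧
      IsFixedBy q 1 (fun k => if k = 0 ∨ k = Fin.last (n + 1) then -1 else 1) y} : ℚ) =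
      2 * ∏ i ∈ Finset.range n, ((q : ℚ) - 2 * (i + 1)) := by
  have hends : ∀ p ∈ selfNegativePairs q, p.1 + p.1 = 0 ∧ p.2 + p.2 = 0 := by
    simp [selfNegativePairs, natCast_add_self]
  have hne : ∀ p ∈ selfNegativePairs q, upToSign p.1 ≠ upToSign p.2 := by
    simp [selfNegativePairs, upToSign_eq_iff, natCast_ne_zero, (natCast_ne_zero q).symm,
      neg_natCast_eq]
  have hgen : ∀ p ∈ selfNegativePairs q, ∀ s ∈ genericClass q 0,
      upToSign s ≠ upToSign p.1 ∧ upToSign s ≠ upToSign p.2 := fun p hp s hs =>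
    ⟨upToSign_ne_of_add_self (hends p hp).1 (mem_genericClass.1 hs).2,
      upToSign_ne_of_add_self (hends p hp).2 (mem_genericClass.1 hs).2⟩
  simp only [isConfiguration_and_isFixedBy_omega_zero_iff hq hn]
  rw [natCard_tuples_with_ends n hne hgen, card_selfNegativePairs, Nat.cast_mul, Nat.cast_ofNat,
    card_separatedTuples_genericClass_zero_of_even hq]

end FixedByOmegaOne

section SymmetricTuples

variable {k : ℕ}

/-- The positions up to the middle one among an odd number of positions. -/
def halfIndex (i : Fin (k + 2)) : Fin (2 * k + 1 + 2) := Fin.castLE (by omega) i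

theorem rev_halfIndex_eq_iff {i j : Fin (k + 2)} :
    (halfIndex i).rev = halfIndex j ↔ i = Fin.last (k + 1) ∧ j = Fin.last (k + 1) := by
  simp only [halfIndex, Fin.ext_iff, Fin.val_rev, Fin.val_castLE, Fin.val_last]
  omega

theorem halfIndex_or_rev (j : Fin (2 * k + 1 + 2)) :
    ∃ i : Fin (k + 2), j = halfIndex i ∨ j = (halfIndex i).rev := by
  refine ⟨⟨min j j.rev, by rw [Fin.val_rev]; omega⟩, ?_⟩
  simp only [halfIndex, Fin.ext_iff, Fin.val_rev, Fin.val_castLE]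
  omega

variable {G : Type*} [AddCommGroup G]

theorem middle_add_middle {c : G} {y : Fin (2 * k + 1 + 2) → G} (hy : ∀ j, y j.rev = c - y j) :
    y (halfIndex (Fin.last (k + 1))) + y (halfIndex (Fin.last (k + 1))) = c := by
  have hmid := hy (halfIndex (Fin.last (k + 1)))
  rw [rev_halfIndex_eq_iff.2 ⟨rfl, rfl⟩] at hmid
  exact eq_sub_iff_add_eq.1 hmid

theorem exists_symmetric_extension {c : G} {w : Fin (k + 2) → G}
    (hw : w (Fin.last (k + 1)) + w (Fin.last (k + 1)) = c) :
    ∃ y : Fin (2 * k + 1 + 2) → G, (∀ j, y j.rev = c - y j) ∧ y ∘ halfIndex = w := by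
  let y (j : Fin (2 * k + 1 + 2)) : G :=
    if hj : j.val < k + 2 then w ⟨j, hj⟩ else c - w ⟨j.rev, by rw [Fin.val_rev]; omega⟩
  have hhalf : ∀ i, y (halfIndex i) = w i := fun i => dif_pos i.isLt
  have hrev : ∀ i, y (halfIndex i).rev = c - w i := fun i => by
    rcases eq_or_ne i (Fin.last (k + 1)) with rfl | hi
    · rw [rev_halfIndex_eq_iff.2 ⟨rfl, rfl⟩, hhalf, ← hw, add_sub_cancel_right]
    · have hlt : i.val < k + 1 := Fin.val_lt_last hi
      refine (dif_neg ?_).trans (by simp [halfIndex])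
      rw [halfIndex, Fin.val_rev, Fin.val_castLE]
      omega
  refine ⟨y, fun j => ?_, funext hhalf⟩
  obtain ⟨i, rfl | rfl⟩ := halfIndex_or_rev j
  · rw [hrev, hhalf]
  · rw [Fin.rev_rev, hrev, hhalf, sub_sub_cancel]

theorem natCard_symmetric (c : G) (p : (Fin (k + 2) → G) → Prop) :
    Nat.card {y : Fin (2 * k + 1 + 2) → G // (∀ j, y j.rev = c - y j) ∧ p (y ∘ halfIndex)} =
      Nat.card {w : Fin (k + 2) → G // w (Fin.last (k + 1)) + w (Fin.last (k + 1)) = c ∧ p w} := by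
  refine Nat.card_eq_of_bijective
    (fun y => ⟨y.1 ∘ halfIndex, middle_add_middle y.2.1, y.2.2⟩) ⟨fun y y' hyy => ?_, ?_⟩
  · have hhalf : ∀ i, y.1 (halfIndex i) = y'.1 (halfIndex i) :=
      fun i => congrFun (congrArg Subtype.val hyy) i
    refine Subtype.ext (funext fun j => ?_)
    obtain ⟨i, rfl | rfl⟩ := halfIndex_or_rev j
    · exact hhalf i
    · rw [y.2.1, y'.2.1, hhalf]
  · rintro ⟨w, hw, hp⟩
    obtain ⟨y, hy, rfl⟩ := exists_symmetric_extension hw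
    exact ⟨⟨y, hy, hp⟩, rfl⟩

end SymmetricTuples

section DoubleClass

variable {q : ℕ}

/-- The class of `a` modulo `a ↦ -a` and `a ↦ a + q`, encoded by `± 2a`. -/
def doubleClass (a : ZMod (2 * q)) : Sym2 (ZMod (2 * q)) := upToSign (a + a)

theorem add_self_eq_add_self_iff {a b : ZMod (2 * q)} : a + a = b + b ↔ a = b ∨ a = b + q := by
  rw [← sub_eq_zero, add_sub_add_comm, add_self_eq_zero_iff, sub_eq_zero, sub_eq_iff_eq_add']

theorem doubleClass_eq_iff {a b : ZMod (2 * q)} :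
    doubleClass a = doubleClass b ↔ upToSign a = upToSign b ∨ upToSign a = upToSign (↑q - b) := by
  have hneg : -((q : ZMod (2 * q)) - b) = b + q := by linear_combination -natCast_add_self q
  rw [doubleClass, doubleClass, upToSign_eq_iff, upToSign_eq_iff, upToSign_eq_iff, neg_add,
    add_self_eq_add_self_iff, add_self_eq_add_self_iff, hneg, neg_add_eq_sub]
  tauto

theorem doubleClass_natCast_sub (a : ZMod (2 * q)) :
    doubleClass ((q : ZMod (2 * q)) - a) = doubleClass a :=
  doubleClass_eq_iff.2 (Or.inr rfl)

theorem doubleClass_eq_of_add_self_eq {a b : ZMod (2 * q)} (hab : a + a = b + b) :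
    doubleClass a = doubleClass b :=
  congrArg upToSign hab

theorem doubleClass_eq_iff_add_self_eq {a b : ZMod (2 * q)} (hb : b + b = 0 ∨ b + b = q) :
    doubleClass a = doubleClass b ↔ a + a = b + b := by
  have hneg : -(b + b) = b + b := by
    rcases hb with hb | hb <;> rw [hb]
    exacts [neg_zero, neg_natCast_eq q]
  rw [doubleClass, doubleClass, upToSign_eq_iff, hneg, or_self]

theorem even_of_add_self_eq {c : ZMod (2 * q)} (hc : c + c = q) : Even q := by
  rw [← ZMod.natCast_eq_zero_iff_even, ← map_natCast (parity q), ← hc, map_add,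
    CharTwo.add_self_eq_zero]

theorem injective_upToSign_comp_iff [NeZero q] {k : ℕ} {y : Fin (2 * k + 1 + 2) → ZMod (2 * q)}
    (hy : ∀ j, y j.rev = q - y j) :
    Function.Injective (upToSign ∘ y) ↔ Function.Injective (doubleClass ∘ y ∘ halfIndex) := by
  constructor
  · intro hinj i j hij
    rcases doubleClass_eq_iff.1 hij with hij | hij
    · exact Fin.castLE_injective _ (hinj hij)
    · rw [Function.comp_apply, Function.comp_apply, ← hy] at hij
      obtain ⟨rfl, rfl⟩ := rev_halfIndex_eq_iff.1 (hinj hij).symm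
      rfl
  · intro hinj
    have hrev : ∀ i, upToSign (y (halfIndex i)) = upToSign (y (halfIndex i).rev) →
        halfIndex i = (halfIndex i).rev := fun i hi => by
      rw [hy, upToSign_eq_iff, neg_sub, eq_sub_iff_add_eq, eq_comm (b := _ - _), sub_eq_self] at hi
      have hdouble := hi.resolve_right (natCast_ne_zero q)
      obtain rfl := hinj (doubleClass_eq_of_add_self_eq
        (hdouble.trans (middle_add_middle hy).symm))
      exact (rev_halfIndex_eq_iff.2 ⟨rfl, rfl⟩).symm
    intro i j hij
    have hij' : doubleClass (y i) = doubleClass (y j) := doubleClass_eq_iff.2 (Or.inl hij)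
    have hfold : ∀ {j i}, j = halfIndex i ∨ j = (halfIndex i).rev →
        doubleClass (y j) = (doubleClass ∘ y ∘ halfIndex) i := by
      rintro _ i (rfl | rfl)
      · rfl
      · rw [hy, doubleClass_natCast_sub, Function.comp_apply, Function.comp_apply]
    obtain ⟨i', hi⟩ := halfIndex_or_rev i
    obtain ⟨j', hj⟩ := halfIndex_or_rev j
    obtain rfl : i' = j' := hinj (((hfold hi).symm.trans hij').trans (hfold hj))
    rcases hi with rfl | rfl <;> rcases hj with rfl | rfl
    exacts [rfl, hrev _ hij, (hrev _ hij.symm).symm, rfl]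

end DoubleClass

section FixedByOmegaLast

variable {k q : ℕ}

/-- The first halves, middle included, of the configurations fixed by `ω_ℓ`. -/
def IsHalfConfiguration (q : ℕ) (w : Fin (k + 2) → ZMod (2 * q)) : Prop :=
  w 0 + w 0 = 0 ∧ (∀ i, parity q (w i) = 0) ∧ Function.Injective (doubleClass ∘ w)

theorem four_dvd_of_add_self_eq {c : ZMod (2 * q)} (hc : c + c = q) (hp : parity q c = 0) :
    4 ∣ q := by
  obtain ⟨r, rfl⟩ := even_of_add_self_eq hc
  obtain ⟨v, rfl⟩ := ZMod.intCast_surjective c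
  rw [map_intCast, ZMod.intCast_zmod_eq_zero_iff_dvd] at hp
  rw [← Int.cast_add, intCast_eq_natCast_iff_exists] at hc
  obtain ⟨s, rfl⟩ := hp
  obtain ⟨t, ht⟩ := hc
  push_cast at ht
  exact Int.natCast_dvd_natCast.1 ⟨s - r * t, by push_cast; linarith⟩

theorem isFixedBy_omega_last_iff {n : ℕ} {y : Fin (n + 2) → ZMod (2 * q)}
    (hy : Function.Injective (upToSign ∘ y)) :
    IsFixedBy q Fin.revPerm (fun k => if k = 0 then 1 else -1) y ↔
      y 0 + y 0 = 0 ∧ ∀ j, y j.rev = q - y j := by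
  have hlast : Fin.last (n + 1) ≠ 0 := Fin.last_pos.ne'
  constructor
  · rintro (hfix | hfix)
    · have h0 : y (Fin.last (n + 1)) = y 0 := by simpa using hfix 0
      exact absurd (hy.of_comp h0) hlast
    · have h0 : y (Fin.last (n + 1)) = y 0 + q := by simpa using hfix 0
      have h1 : -y 0 = y (Fin.last (n + 1)) + q := by simpa [hlast] using hfix (Fin.last (n + 1))
      have h00 : y 0 + y 0 = 0 := by linear_combination -h1 - h0 - natCast_add_self q
      refine ⟨h00, fun j => ?_⟩
      rcases eq_or_ne j 0 with rfl | hj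
      · rw [Fin.rev_zero, h0]
        linear_combination h00
      · have hneg : -y j.rev = y j + q := by simpa [hj] using hfix j
        linear_combination -hneg - natCast_add_self q
  · rintro ⟨h0, hrev⟩
    refine Or.inr fun j => ?_
    rw [Fin.revPerm_apply, hrev]
    rcases eq_or_ne j 0 with rfl | hj
    · simp only [if_true, Units.val_one, Int.cast_one]
      linear_combination -h0
    · simp only [hj, if_false, Units.val_neg, Units.val_one, Int.cast_neg, Int.cast_one]
      linear_combination -natCast_add_self q

variable [NeZero q]

theorem isConfiguration_and_isFixedBy_omega_last_iff {y : Fin (2 * k + 1 + 2) → ZMod (2 * q)} :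
    IsConfiguration q y ∧ IsFixedBy q Fin.revPerm (fun k => if k = 0 then 1 else -1) y ↔
      (∀ j, y j.rev = q - y j) ∧ IsHalfConfiguration q (y ∘ halfIndex) := by
  constructor
  · rintro ⟨⟨hpar, hinj⟩, hfix⟩
    obtain ⟨h0, hrev⟩ := (isFixedBy_omega_last_iff hinj).1 hfix
    have hq : Even q := even_of_add_self_eq (middle_add_middle hrev)
    refine ⟨hrev, h0, fun i => ?_, (injective_upToSign_comp_iff hrev).1 hinj⟩
    rw [Function.comp_apply, hpar _ 0, parity_eq_zero_of_add_self hq h0]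
  · rintro ⟨hrev, h0, hhalf, hinj⟩
    have hinj := (injective_upToSign_comp_iff hrev).2 hinj
    have hq : Even q := even_of_add_self_eq (middle_add_middle hrev)
    have hpar : ∀ j, parity q (y j) = 0 := fun j => by
      obtain ⟨i, rfl | rfl⟩ := halfIndex_or_rev j
      · exact hhalf i
      · rw [hrev, map_sub, parity_natCast_self_of_even hq, zero_sub, neg_eq_zero]
        exact hhalf i
    exact ⟨⟨fun k l => by rw [hpar, hpar], hinj⟩, (isFixedBy_omega_last_iff hinj).2 ⟨h0, hrev⟩⟩

theorem natCard_fixedBy_omega_last_eq (k : ℕ) :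
    Nat.card {y : Fin (2 * k + 1 + 2) → ZMod (2 * q) // IsConfiguration q y ∧
      IsFixedBy q Fin.revPerm (fun k => if k = 0 then 1 else -1) y} =
    Nat.card {w : Fin (k + 2) → ZMod (2 * q) //
      w (Fin.last (k + 1)) + w (Fin.last (k + 1)) = q ∧ IsHalfConfiguration q w} := by
  simp only [isConfiguration_and_isFixedBy_omega_last_iff]
  exact natCard_symmetric (q : ZMod (2 * q)) (IsHalfConfiguration q)

theorem natCard_fixedBy_omega_last_of_not_dvd (hq : ¬4 ∣ q) (k : ℕ) :
    Nat.card {y : Fin (2 * k + 1 + 2) → ZMod (2 * q) // IsConfiguration q y ∧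
      IsFixedBy q Fin.revPerm (fun k => if k = 0 then 1 else -1) y} = 0 := by
  rw [natCard_fixedBy_omega_last_eq, Nat.card_eq_zero]
  exact Or.inl ⟨fun w => hq (four_dvd_of_add_self_eq w.2.1 (w.2.2.2.1 _))⟩

theorem filter_add_self_eq {r : ℕ} (hr : q = 2 * r) :
    ({a | a + a = q} : Finset (ZMod (2 * q))) = {(r : ZMod (2 * q)), (r : ZMod (2 * q)) + q} := by
  have hrr : (q : ZMod (2 * q)) = r + r := by
    rw [← Nat.cast_add, ← two_mul, ← hr]
  ext a
  rw [Finset.mem_filter_univ, Finset.mem_insert, Finset.mem_singleton,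
    ← add_self_eq_add_self_iff, hrr]

theorem card_filter_add_self_eq (hq : Even q) :
    ({a | a + a = q} : Finset (ZMod (2 * q))).card = 2 := by
  obtain ⟨r, hr⟩ := hq.two_dvd
  rw [filter_add_self_eq hr]
  exact Finset.card_pair fun h => natCast_ne_zero q (left_eq_add.1 h)

theorem parity_of_add_self_eq (hq : 4 ∣ q) {a : ZMod (2 * q)} (ha : a + a = q) :
    parity q a = 0 := by
  obtain ⟨r, hr⟩ := hq
  have hmem := (filter_add_self_eq (r := 2 * r) (by omega)).le (Finset.mem_filter_univ a |>.2 ha)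
  have hrpar : parity q ((2 * r : ℕ) : ZMod (2 * q)) = 0 := by
    rw [map_natCast, ZMod.natCast_eq_zero_iff]
    exact dvd_mul_right 2 r
  rw [Finset.mem_insert, Finset.mem_singleton] at hmem
  rcases hmem with rfl | rfl
  · exact hrpar
  · rw [map_add, hrpar, zero_add, parity_natCast_self_of_even (by grind)]

/-- The elements of `ZMod (2 * q)` of parity `0` whose double is neither `0` nor `q`: these are the
possible inner coordinates of a half configuration. -/
def innerClass (q : ℕ) [NeZero q] : Finset (ZMod (2 * q)) := {a ∈ genericClass q 0 | a + a ≠ q}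

theorem mem_innerClass {a : ZMod (2 * q)} :
    a ∈ innerClass q ↔ parity q a = 0 ∧ a + a ≠ 0 ∧ a + a ≠ q := by
  rw [innerClass, Finset.mem_filter, mem_genericClass, and_assoc]

theorem card_innerClass (hq : 4 ∣ q) : ((innerClass q).card : ℚ) = q - 4 := by
  have heven : Even q := even_iff_two_dvd.2 (dvd_trans (by norm_num) hq)
  have hsplit := Finset.card_filter_add_card_filter_not (s := genericClass q 0)
    fun a : ZMod (2 * q) => a + a = q
  have hfilter : ({a ∈ genericClass q 0 | a + a = (q : ZMod (2 * q))} : Finset _) =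
      ({a | a + a = q} : Finset (ZMod (2 * q))) := by
    ext a
    rw [Finset.mem_filter, Finset.mem_filter_univ, mem_genericClass, and_iff_right_iff_imp]
    exact fun ha => ⟨parity_of_add_self_eq hq ha, ha.trans_ne (natCast_ne_zero q)⟩
  rw [hfilter, card_filter_add_self_eq heven] at hsplit
  change 2 + (innerClass q).card = _ at hsplit
  have hcard := card_genericClass_zero_of_even heven
  rw [← hsplit] at hcard
  push_cast at hcard
  linarith

theorem neg_mem_innerClass {a : ZMod (2 * q)} (ha : a ∈ innerClass q) : -a ∈ innerClass q := by
  obtain ⟨hpar, h0, hq'⟩ := mem_innerClass.1 ha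
  refine mem_innerClass.2 ⟨by rw [parity_neg, hpar], ?_, ?_⟩
  · rwa [← neg_add, Ne, neg_eq_zero]
  · rwa [← neg_add, Ne, neg_eq_iff_eq_neg, neg_natCast_eq]

theorem natCast_sub_mem_innerClass (hq : Even q) {a : ZMod (2 * q)} (ha : a ∈ innerClass q) :
    ↑q - a ∈ innerClass q := by
  have hdouble : (q : ZMod (2 * q)) - a + (q - a) = -a + -a := by
    linear_combination natCast_add_self q
  obtain ⟨hpar, hdoubles⟩ := mem_innerClass.1 (neg_mem_innerClass ha)
  refine mem_innerClass.2 ⟨?_, by rwa [hdouble]⟩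
  rw [sub_eq_add_neg, map_add, hpar, parity_natCast_self_of_even hq, add_zero]

theorem card_filter_doubleClass_eq (hq : Even q) {a : ZMod (2 * q)} (ha : a ∈ innerClass q) :
    {x ∈ innerClass q | doubleClass x = doubleClass a}.card = 4 := by
  have hsub := natCast_sub_mem_innerClass hq ha
  have hfiber : {x ∈ innerClass q | doubleClass x = doubleClass a} =
      ({a, -a} : Finset _) ∪ {↑q - a, -(↑q - a)} := by
    ext x
    simp only [Finset.mem_filter, doubleClass_eq_iff, upToSign_eq_iff, Finset.mem_insert,
      Finset.mem_singleton, Finset.mem_union, and_iff_right_iff_imp]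
    rintro ((rfl | rfl) | rfl | rfl)
    exacts [ha, neg_mem_innerClass ha, hsub, neg_mem_innerClass hsub]
  have hpair : ∀ b ∈ innerClass q, ({b, -b} : Finset _).card = 2 := fun b hb =>
    Finset.card_pair fun h => (mem_innerClass.1 hb).2.1 (add_eq_zero_iff_eq_neg.2 h)
  have hne : a ≠ ↑q - a := fun h => (mem_innerClass.1 ha).2.2 (eq_sub_iff_add_eq.1 h)
  rw [hfiber, Finset.card_union_of_disjoint, hpair a ha, hpair _ hsub]
  simp [hne.symm, natCast_ne_zero, neg_eq_iff_eq_neg, -neg_sub]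

theorem card_separatedTuples_innerClass (hq : 4 ∣ q) (k : ℕ) :
    ((separatedTuples doubleClass k (innerClass q)).card : ℚ) =
      ∏ i ∈ Finset.range k, ((q : ℚ) - 4 * (i + 1)) := by
  have heven : Even q := even_iff_two_dvd.2 (dvd_trans (by norm_num) hq)
  rw [card_separatedTuples_of_card_fiber (d := 4) k _ fun a => card_filter_doubleClass_eq heven,
    card_innerClass hq]
  exact Finset.prod_congr rfl fun i _ => by push_cast; ring

/-- The pairs of ends of the half configurations. -/
def halfConfigurationEnds (q : ℕ) [NeZero q] : Finset (ZMod (2 * q) × ZMod (2 * q)) :=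
  ({a | a + a = 0} : Finset (ZMod (2 * q))) ×ˢ ({a | a + a = q} : Finset (ZMod (2 * q)))

theorem mem_halfConfigurationEnds {p : ZMod (2 * q) × ZMod (2 * q)} :
    p ∈ halfConfigurationEnds q ↔ p.1 + p.1 = 0 ∧ p.2 + p.2 = q := by
  rw [halfConfigurationEnds, Finset.mem_product, Finset.mem_filter_univ, Finset.mem_filter_univ]

theorem card_halfConfigurationEnds (hq : Even q) : (halfConfigurationEnds q).card = 4 := by
  have hzero : ({a | a + a = 0} : Finset (ZMod (2 * q))) = {0, (q : ZMod (2 * q))} := by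
    ext a
    simp [add_self_eq_zero_iff]
  rw [halfConfigurationEnds, Finset.card_product, card_filter_add_self_eq hq, hzero,
    Finset.card_pair (natCast_ne_zero q).symm]

theorem middle_and_isHalfConfiguration_iff (hq : 4 ∣ q) {w : Fin (k + 2) → ZMod (2 * q)} :
    w (Fin.last (k + 1)) + w (Fin.last (k + 1)) = q ∧ IsHalfConfiguration q w ↔
      (w 0, w (Fin.last (k + 1))) ∈ halfConfigurationEnds q ∧
        (∀ i : Fin k, w i.castSucc.succ ∈ innerClass q) ∧
          Function.Injective (doubleClass ∘ w) := by
  rw [IsHalfConfiguration, mem_halfConfigurationEnds]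
  constructor
  · rintro ⟨hlast, h0, hpar, hinj⟩
    refine ⟨⟨h0, hlast⟩, fun i => mem_innerClass.2 ⟨hpar _, fun hi => ?_, fun hi => ?_⟩, hinj⟩
    · exact hinj.ne (Fin.succ_ne_zero i.castSucc)
        (doubleClass_eq_of_add_self_eq (hi.trans h0.symm))
    · exact hinj.ne (Fin.castSucc_lt_last i.succ).ne
        (doubleClass_eq_of_add_self_eq (hi.trans hlast.symm))
  · rintro ⟨⟨h0, hlast⟩, hinner, hinj⟩
    have heven : Even q := even_iff_two_dvd.2 (dvd_trans (by norm_num) hq)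
    refine ⟨hlast, h0, Fin.cases (parity_eq_zero_of_add_self heven h0) fun i => ?_, hinj⟩
    refine Fin.lastCases (parity_of_add_self_eq hq hlast) (fun i => ?_) i
    exact (mem_innerClass.1 (hinner i)).1

theorem natCard_fixedBy_omega_last_of_dvd (hq : 4 ∣ q) (k : ℕ) :
    (Nat.card {y : Fin (2 * k + 1 + 2) → ZMod (2 * q) // IsConfiguration q y ∧
      IsFixedBy q Fin.revPerm (fun k => if k = 0 then 1 else -1) y} : ℚ) =
      4 * ∏ i ∈ Finset.range k, ((q : ℚ) - 4 * (i + 1)) := by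
  have hne : ∀ p ∈ halfConfigurationEnds q, doubleClass p.1 ≠ doubleClass p.2 := fun p hp => by
    obtain ⟨h1, h2⟩ := mem_halfConfigurationEnds.1 hp
    rw [Ne, doubleClass_eq_iff_add_self_eq (Or.inr h2), h1, h2]
    exact (natCast_ne_zero q).symm
  have hinner : ∀ p ∈ halfConfigurationEnds q, ∀ s ∈ innerClass q,
      doubleClass s ≠ doubleClass p.1 ∧ doubleClass s ≠ doubleClass p.2 := fun p hp s hs => by
    obtain ⟨h1, h2⟩ := mem_halfConfigurationEnds.1 hp
    obtain ⟨_, hs⟩ := mem_innerClass.1 hs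
    rwa [Ne, Ne, doubleClass_eq_iff_add_self_eq (Or.inl h1),
      doubleClass_eq_iff_add_self_eq (Or.inr h2), h1, h2]
  have heven : Even q := even_iff_two_dvd.2 (dvd_trans (by norm_num) hq)
  rw [natCard_fixedBy_omega_last_eq]
  simp only [middle_and_isHalfConfiguration_iff hq]
  rw [natCard_tuples_with_ends k hne hinner, card_halfConfigurationEnds heven, Nat.cast_mul,
    Nat.cast_ofNat, card_separatedTuples_innerClass hq]

end FixedByOmegaLast

section Values

variable {n : ℕ} {ι M N : Type*} [AddCommGroup M] [Module ℝ M] [AddCommGroup N] [Module ℝ N]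
  {P : RootPairing ι ℝ M N} {φ : N ≃ₗ[ℝ] (Fin (n + 2) → ℝ)}

theorem ActsBy.orderOf_eq_four {w : P.weylGroup}
    (hw : ActsBy φ w Fin.revPerm fun k => if k = 0 then 1 else -1) : orderOf w = 4 := by
  have hrev : (Fin.revPerm * Fin.revPerm : Equiv.Perm (Fin (n + 2))) = 1 := by
    ext k
    rw [Equiv.Perm.mul_apply, Fin.revPerm_apply, Fin.revPerm_apply, Fin.rev_rev,
      Equiv.Perm.one_apply]
  have hsq := hw.mul hw
  rw [hrev, ← sq] at hsq
  have hfourth : w ^ 2 * w ^ 2 = 1 := by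
    refine ActsBy.unique (σ := 1) (ε := 1) (φ := φ) ?_ actsBy_one
    convert! hsq.mul hsq using 1
    ext k : 1
    exact (Int.units_mul_self _).symm
  have hsq_ne : w ^ 2 ≠ 1 := fun h => by
    have hcoord := hsq (φ.symm (Pi.single 0 1)) 0
    rw [h, map_one, LinearEquiv.coe_one, id, LinearEquiv.apply_symm_apply] at hcoord
    norm_num [Fin.ext_iff, Pi.single_apply] at hcoord
  exact orderOf_eq_prime_pow (p := 2) (n := 1) hsq_ne ((pow_add w 2 2).trans hfourth)

variable [Finite ι] [P.IsCrystallographic] [P.IsReduced] {b : P.Base}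
  {e : Fin (n + 2) ≃ b.support} {q : ℕ} [NeZero q]

theorem two_mul_equivChar_one (h : IsStandard b e φ) :
    2 * equivChar P q 1 = Nat.card {y : Fin (n + 2) → ZMod (2 * q) // IsConfiguration q y} := by
  have hfixed : ∀ y : Fin (n + 2) → ZMod (2 * q), IsFixedBy q 1 1 y := fun y => Or.inl (by simp)
  simpa only [hfixed, and_true] using two_mul_equivChar h (q := q) (actsBy_one (P := P) (φ := φ))

theorem equivChar_one_of_odd (h : IsStandard b e φ) (hq : Odd q) :
    (equivChar P q 1 : ℚ) =
      (∏ i ∈ Finset.range (n + 1), ((q : ℚ) - (2 * i + 1))) * (q - (n + 1)) := by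
  have hcount := natCard_isConfiguration_of_odd hq (n + 1)
  rw [← two_mul_equivChar_one h, Nat.cast_mul, Nat.cast_ofNat, Nat.cast_succ] at hcount
  exact mul_left_cancel₀ two_ne_zero hcount

theorem equivChar_one_of_even (h : IsStandard b e φ) (hq : Even q) :
    (equivChar P q 1 : ℚ) = (∏ i ∈ Finset.range n, ((q : ℚ) - 2 * (i + 1))) *
      ((q : ℚ) ^ 2 - 2 * (n + 1) * q + (n + 2) * (n + 1) / 2) := by
  have hcount := natCard_isConfiguration_of_even hq n
  rw [← two_mul_equivChar_one h, Nat.cast_mul, Nat.cast_ofNat] at hcount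
  exact mul_left_cancel₀ two_ne_zero hcount

theorem equivChar_omega_zero_of_odd [P.IsRootSystem] (h : IsStandard b e φ) (hn : n ≠ 0)
    (hq : Odd q) : equivChar P q (omega b (e 0)) = 0 := by
  have hcount := two_mul_equivChar h (q := q) (h.actsBy_omega_zero hn)
  rw [natCard_fixedBy_omega_zero_of_odd hq hn] at hcount
  exact (mul_eq_zero.1 hcount).resolve_left two_ne_zero

theorem equivChar_omega_zero_of_even [P.IsRootSystem] (h : IsStandard b e φ) (hn : n ≠ 0)
    (hq : Even q) : (equivChar P q (omega b (e 0)) : ℚ) =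
      ∏ i ∈ Finset.range n, ((q : ℚ) - 2 * (i + 1)) := by
  have hcount := natCard_fixedBy_omega_zero_of_even hq hn
  rw [← two_mul_equivChar h (h.actsBy_omega_zero hn), Nat.cast_mul, Nat.cast_ofNat] at hcount
  exact mul_left_cancel₀ two_ne_zero hcount

end Values

section OddRank

variable {k : ℕ} {ι M N : Type*} [Finite ι] [AddCommGroup M] [Module ℝ M] [AddCommGroup N]
  [Module ℝ N] {P : RootPairing ι ℝ M N} [P.IsRootSystem] [P.IsCrystallographic] [P.IsReduced]
  {b : P.Base} {e : Fin (2 * k + 1 + 2) ≃ b.support} {φ : N ≃ₗ[ℝ] (Fin (2 * k + 1 + 2) → ℝ)}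

theorem IsStandard.actsBy_omega_last_of_odd (h : IsStandard b e φ) :
    ActsBy φ (omega b (e (Fin.last (2 * k + 1 + 1)))) Fin.revPerm
      fun i => if i = 0 then 1 else -1 := by
  have heven : Even (2 * k + 1 + 1) := ⟨k + 1, by ring⟩
  simpa only [heven.neg_one_pow] using h.actsBy_omega_last

theorem orderOf_omega_last (h : IsStandard b e φ) :
    orderOf (omega b (e (Fin.last (2 * k + 1 + 1)))) = 4 :=
  h.actsBy_omega_last_of_odd.orderOf_eq_four

variable {q : ℕ} [NeZero q]

theorem equivChar_omega_last_of_not_dvd (h : IsStandard b e φ) (hq : ¬4 ∣ q) :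
    equivChar P q (omega b (e (Fin.last (2 * k + 1 + 1)))) = 0 := by
  have hcount := two_mul_equivChar h (q := q) h.actsBy_omega_last_of_odd
  rw [natCard_fixedBy_omega_last_of_not_dvd hq] at hcount
  exact (mul_eq_zero.1 hcount).resolve_left two_ne_zero

theorem equivChar_omega_last_of_dvd (h : IsStandard b e φ) (hq : 4 ∣ q) :
    (equivChar P q (omega b (e (Fin.last (2 * k + 1 + 1)))) : ℚ) =
      2 * ∏ i ∈ Finset.range k, ((q : ℚ) - 4 * (i + 1)) := by
  have hcount := natCard_fixedBy_omega_last_of_dvd hq k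
  rw [← two_mul_equivChar h h.actsBy_omega_last_of_odd, Nat.cast_mul, Nat.cast_ofNat] at hcount
  linarith

end OddRank

section MainTheorem

variable {ι M N : Type*} [AddCommGroup M] [Module ℝ M] [AddCommGroup N] [Module ℝ N]
  {P : RootPairing ι ℝ M N} [P.IsRootSystem] [P.IsCrystallographic] {b : P.Base}

theorem IsTypeD.exists_isStandard_omega_last {n : ℕ} {e : Fin (n + 2) ≃ b.support}
    (hD : IsTypeD b e) (hn : n ≠ 0) {ω : P.weylGroup}
    (hω : ω = omega b (e (Fin.last n).castSucc) ∨ ω = omega b (e (Fin.last (n + 1)))) :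
    ∃ e' φ, IsStandard b e' φ ∧ omega b (e' (Fin.last (n + 1))) = ω := by
  rcases hω with rfl | rfl
  · obtain ⟨φ, hφ⟩ := exists_isStandard hn hD.swap
    exact ⟨_, φ, hφ, by rw [Equiv.trans_apply, Equiv.swap_apply_right]⟩
  · obtain ⟨φ, hφ⟩ := exists_isStandard hn hD
    exact ⟨e, φ, hφ, rfl⟩

end MainTheorem

end EquivariantQuasi

open EquivariantQuasi in
theorem mainTheorem10_general {ι M N : Type*} [Finite ι] [AddCommGroup M] [Module ℝ M]
    [AddCommGroup N] [Module ℝ N] (P : RootPairing ι ℝ M N)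
    [P.IsRootSystem] [P.IsCrystallographic] [P.IsReduced] (b : P.Base)
    (ℓ : ℕ) (hℓ : 3 ≤ ℓ) (e : Fin ℓ ≃ b.support) (hD : IsTypeD b e) :
    (∀ q : ℕ, 0 < q → ¬ 2 ∣ q →
      (equivChar P q 1 : ℚ) =
        (∏ i ∈ Finset.range (ℓ - 1), ((q : ℚ) - (2 * (i : ℚ) + 1))) *
          ((q : ℚ) - ((ℓ : ℚ) - 1))) ∧
    (∀ q : ℕ, 0 < q → 2 ∣ q →
      (equivChar P q 1 : ℚ) =
        (∏ i ∈ Finset.range (ℓ - 2), ((q : ℚ) - 2 * ((i : ℚ) + 1))) *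
          ((q : ℚ) ^ 2 - 2 * ((ℓ : ℚ) - 1) * q + (ℓ : ℚ) * ((ℓ : ℚ) - 1) / 2)) ∧
    (∀ q : ℕ, 0 < q → ¬ 2 ∣ q →
      equivChar P q
        (omega b (e ⟨0, by omega⟩)) = 0) ∧
    (∀ q : ℕ, 0 < q → 2 ∣ q →
      (equivChar P q
        (omega b (e ⟨0, by omega⟩)) : ℚ) =
          ∏ i ∈ Finset.range (ℓ - 2), ((q : ℚ) - 2 * ((i : ℚ) + 1))) ∧
    (Odd ℓ → ∀ ω : P.weylGroup,
      ω = omega b (e ⟨ℓ - 2, by omega⟩) ∨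
        ω = omega b (e ⟨ℓ - 1, by omega⟩) →
      orderOf ω = 4 ∧
      (∀ q : ℕ, 0 < q → ¬ 4 ∣ q → equivChar P q ω = 0) ∧
      (∀ q : ℕ, 0 < q → 4 ∣ q →
        (equivChar P q ω : ℚ) =
          2 * ∏ i ∈ Finset.range ((ℓ - 3) / 2), ((q : ℚ) - 4 * ((i : ℚ) + 1)))) := by
  obtain ⟨n, rfl⟩ : ∃ n, ℓ = n + 2 := ⟨ℓ - 2, by omega⟩
  have hn : n ≠ 0 := by omega
  have hcast : ((n + 2 : ℕ) : ℚ) - 1 = n + 1 := by push_cast; ring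
  obtain ⟨φ, hφ⟩ := exists_isStandard hn hD
  refine ⟨fun q hq h2 => ?_, fun q hq h2 => ?_, fun q hq h2 => ?_, fun q hq h2 => ?_,
    fun hodd ω hω => ?_⟩
  · have : NeZero q := ⟨hq.ne'⟩
    rw [hcast]
    exact equivChar_one_of_odd hφ (Nat.odd_iff.2 (Nat.two_dvd_ne_zero.1 h2))
  · have : NeZero q := ⟨hq.ne'⟩
    rw [hcast, Nat.cast_add, Nat.cast_ofNat]
    exact equivChar_one_of_even hφ (even_iff_two_dvd.2 h2)
  · have : NeZero q := ⟨hq.ne'⟩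
    exact equivChar_omega_zero_of_odd hφ hn (Nat.odd_iff.2 (Nat.two_dvd_ne_zero.1 h2))
  · have : NeZero q := ⟨hq.ne'⟩
    exact equivChar_omega_zero_of_even hφ hn (even_iff_two_dvd.2 h2)
  · obtain ⟨k, rfl⟩ : ∃ k, n = 2 * k + 1 := hodd.elim fun m hm => ⟨m - 1, by omega⟩
    rw [show (2 * k + 1 + 2 - 3) / 2 = k by omega]
    obtain ⟨e', ψ, hψ, rfl⟩ := hD.exists_isStandard_omega_last hn hω
    exact ⟨orderOf_omega_last hψ,
      fun q hq h4 => have : NeZero q := ⟨hq.ne'⟩; equivChar_omega_last_of_not_dvd hψ h4,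
      fun q hq h4 => have : NeZero q := ⟨hq.ne'⟩; equivChar_omega_last_of_dvd hψ h4⟩

theorem mainTheorem10 {ι M N : Type*} [Finite ι] [AddCommGroup M] [Module ℝ M]
    [AddCommGroup N] [Module ℝ N] (P : RootPairing ι ℝ M N)
    [P.IsRootSystem] [P.IsCrystallographic] [P.IsReduced] (b : P.Base)
    (ℓ : ℕ) (hℓ : 4 ≤ ℓ) (hodd : Odd ℓ) (e : Fin ℓ ≃ b.support)
    (hD : EquivariantQuasi.IsTypeD b e) :
    -- the value at `1`
    (∀ q : ℕ, 0 < q → ¬ 2 ∣ q →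
      (EquivariantQuasi.equivChar P q 1 : ℚ) =
        (∏ i ∈ Finset.range (ℓ - 1), ((q : ℚ) - (2 * (i : ℚ) + 1))) *
          ((q : ℚ) - ((ℓ : ℚ) - 1))) ∧
    (∀ q : ℕ, 0 < q → 2 ∣ q →
      (EquivariantQuasi.equivChar P q 1 : ℚ) =
        (∏ i ∈ Finset.range (ℓ - 2), ((q : ℚ) - 2 * ((i : ℚ) + 1))) *
          ((q : ℚ) ^ 2 - 2 * ((ℓ : ℚ) - 1) * q + (ℓ : ℚ) * ((ℓ : ℚ) - 1) / 2)) ∧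
    -- the value at `ω_1`
    (∀ q : ℕ, 0 < q → ¬ 2 ∣ q →
      EquivariantQuasi.equivChar P q
        (EquivariantQuasi.omega b (e ⟨0, by omega⟩)) = 0) ∧
    (∀ q : ℕ, 0 < q → 2 ∣ q →
      (EquivariantQuasi.equivChar P q
        (EquivariantQuasi.omega b (e ⟨0, by omega⟩)) : ℚ) =
          ∏ i ∈ Finset.range (ℓ - 2), ((q : ℚ) - 2 * ((i : ℚ) + 1))) ∧
    -- the values at `ω_{ℓ-1}` and `ω_ℓ`
    (∀ ω : P.weylGroup,
      ω = EquivariantQuasi.omega b (e ⟨ℓ - 2, by omega⟩) ∨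
        ω = EquivariantQuasi.omega b (e ⟨ℓ - 1, by omega⟩) →
      orderOf ω = 4 ∧
      (∀ q : ℕ, 0 < q → ¬ 4 ∣ q → EquivariantQuasi.equivChar P q ω = 0) ∧
      (∀ q : ℕ, 0 < q → 4 ∣ q →
        (EquivariantQuasi.equivChar P q ω : ℚ) =
          2 * ∏ i ∈ Finset.range ((ℓ - 3) / 2), ((q : ℚ) - 4 * ((i : ℚ) + 1)))) := by
  obtain ⟨one_odd, one_even, omega_odd, omega_even, omega_last⟩ :=
    mainTheorem10_general P b ℓ (by omega) e hD
  exact ⟨one_odd, one_even, omega_odd, omega_even, omega_last hodd⟩
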